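/- Let $n\ge 2$ and let $-L$ be a Kossakowski--Lindblad generator on $\mathbb C^{n\times n}$, i.e. $L(\rho)=\mathrm i[H_0,\rho]+\sum_{k=1}^r\big(\tfrac12(V_k^*V_k\rho+\rho V_k^*V_k)-V_k\rho V_k^*\big)$ with $H_0$ Hermitian and $V_1,\dots,V_r\in\mathbb C^{n\times n}$ arbitrary. For $U\in\mathrm{SU}(n)$ let $-L_U$ be the linear vector field on $\mathbb R^n$ with $(-L_U\lambda)_i=-\big(U^*L(U\,\mathrm{diag}(\lambda)\,U^*)\,U\big)_{ii}$, and put $\mathsf{derv}(\lambda)=\{-L_U\lambda: U\in\mathrm{SU}(n)\}$. Let $\Delta^{n-1}\subset\mathbb R^n$ be the standard simplex. For an interval $I=[0,T]$ or $I=[0,\infty)$ consider (locally) absolutely continuous paths $\lambda:I\to\Delta^{n-1}$. Such a path is a solution of (R) if $\dot\lambda(t)=-L_{U(t)}\lambda(t)$ for almost every $t$, for some measurable $U:I\to\mathrm{SU}(n)$, and a solution of (C) if $\dot\lambda(t)\in\mathrm{conv}(\mathsf{derv}(\lambda(t)))$ for almost every $t$. Let $\mathsf{reach}(\lambda_0)$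 be the set of all $\lambda(T)$, where $T\ge0$ and $\lambda:[0,T]\to\Delta^{n-1}$ is a solution of (R) with $\lambda(0)=\lambda_0$. A nonempty proper face $F$ of $\Delta^{n-1}$ (vertices allowed) is called - *directly reachable* if there is a solution $\lambda:[0,\infty)\to\Delta^{n-1}$ of (C) with $\lambda(0)\notin F$ which converges, as $t\to\infty$, to a point of the relative interior of $F$; - *approximately reachable* if there is $\lambda\in\Delta^{n-1}\setminus F$ such that $\overline{\mathsf{reach}(\lambda)}\cap\mathrm{relint}(F)\neq\emptyset$; - *viable* if for every $\lambda_0\in F$ there is a solution $\lambda:[0,\infty)\to F$ of (C) with $\lambda(0)=\lambda_0$; - *purely Hamiltonian* if every $-L_U$, $U\in\mathrm{SU}(n)$, whose restriction to $F$ is tangent to $F$ vanishes on $F$. Let $F$ be a nonempty proper face of $\Delta^{n-1}$, and consider the following statements: (i) $F$ is directly reachable, or else $F$ is viable, not purely Hamiltonian, and some nonempty face of $\Delta^{n-1}$ of dimension smaller than $\dim F$ is approximately reachable. (ii) $F$ is approximately reachable. (iii) $F$ is directly reachable, or else $F$ is viable and some nonempty face of $\Delta^{n-1}$ of dimension smaller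 than $\dim F$ is approximately reachable. Then (i) implies (ii), and (ii) implies (iii). -/

import Mathlib

open Set Filter Topology MeasureTheory
open scoped Matrix

noncomputable section

/-- Complex `n × n` matrices. -/
abbrev CMat (n : ℕ) : Type := Matrix (Fin n) (Fin n) ℂ

/-- The special unitary group `SU(n)`, as a set of matrices. -/
abbrev SUn (n : ℕ) : Set (CMat n) := (Matrix.specialUnitaryGroup (Fin n) ℂ : Set (CMat n))

/-- The dissipator `Γ_V(ρ) = ½ (V* V ρ + ρ V* V) - V ρ V*` of a single Lindblad term `V`. -/
def dissipator {n : ℕ} (V ρ : CMat n) : CMat n :=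
  (1 / 2 : ℂ) • (Vᴴ * V * ρ + ρ * (Vᴴ * V)) - V * ρ * Vᴴ

/-- The set of Kossakowski--Lindblad generators
`-L = -(i ad_{H₀} + ∑ₖ Γ_{Vₖ})` with `H₀` Hermitian and finitely many arbitrary `Vₖ`. -/
def KossakowskiLindblad (n : ℕ) : Set (CMat n → CMat n) :=
  {A | ∃ (r : ℕ) (H₀ : CMat n) (V : Fin r → CMat n), H₀.IsHermitian ∧
    ∀ ρ, A ρ = -(Complex.I • (H₀ * ρ - ρ * H₀) + ∑ k, dissipator (V k) ρ)}

section ReducedSystem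

variable {n : ℕ} (L : CMat n → CMat n)

/-- The induced vector field `-L_U = -Π_diag ∘ Ad_U⁻¹ ∘ L ∘ Ad_U ∘ diag` on `ℝⁿ`
(the diagonal entries are real for a generator `-L` and `U` unitary). -/
def inducedField (U : CMat n) (x : Fin n → ℝ) : Fin n → ℝ :=
  fun i => -((Uᴴ * L (U * Matrix.diagonal (fun j => (x j : ℂ)) * Uᴴ) * U) i i).re

/-- The achievable derivatives `derv(x) = {-L_U x : U ∈ SU(n)}`. -/
def derv (x : Fin n → ℝ) : Set (Fin n → ℝ) :=
  (fun U => inducedField L U x) '' SUn n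

/-- (Local) absolute continuity of a path on an interval `I`. -/
def AbsContOn (I : Set ℝ) (x : ℝ → Fin n → ℝ) : Prop :=
  ∀ a ∈ I, ∀ b ∈ I, AbsolutelyContinuousOnInterval x a b

/-- `x : I → Δ^{n-1}` solves the reduced control system `ẋ(t) = -L_{U(t)} x(t)` for some
measurable control `U : I → SU(n)`. Values outside of the interval `I` are irrelevant. -/
def IsReducedSolution (I : Set ℝ) (x : ℝ → Fin n → ℝ) : Prop :=
  (∀ t ∈ I, x t ∈ stdSimplex ℝ (Fin n)) ∧ AbsContOn I x ∧
  ∃ U : ℝ → CMat n, (∀ i j, Measurable fun t => U t i j) ∧ (∀ t, U t ∈ SUn n) ∧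
    ∀ᵐ t ∂(volume.restrict I), HasDerivAt x (inducedField L (U t) (x t)) t

/-- `x : I → Δ^{n-1}` solves the relaxed control system `ẋ(t) ∈ conv(derv(x(t)))`.
Values outside of the interval `I` are irrelevant. -/
def IsRelaxedSolution (I : Set ℝ) (x : ℝ → Fin n → ℝ) : Prop :=
  (∀ t ∈ I, x t ∈ stdSimplex ℝ (Fin n)) ∧ AbsContOn I x ∧
  ∀ᵐ t ∂(volume.restrict I), ∃ v ∈ convexHull ℝ (derv L (x t)), HasDerivAt x v t

/-- The all-time reachable set of `x₀` in the reduced control system. -/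
def reach (x₀ : Fin n → ℝ) : Set (Fin n → ℝ) :=
  {y | ∃ T : ℝ, 0 ≤ T ∧ ∃ x : ℝ → Fin n → ℝ,
    IsReducedSolution L (Icc 0 T) x ∧ x 0 = x₀ ∧ x T = y}

/-- The face `conv {eᵢ : i ∈ S}` of the standard simplex, of dimension `#S - 1`. -/
def simplexFace (S : Finset (Fin n)) : Set (Fin n → ℝ) :=
  {x | x ∈ stdSimplex ℝ (Fin n) ∧ ∀ i ∉ S, x i = 0}

/-- `F` is viable for the relaxed control system. -/
def IsViable (F : Set (Fin n → ℝ)) : Prop :=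
  ∀ x₀ ∈ F, ∃ x : ℝ → Fin n → ℝ,
    IsRelaxedSolution L (Ici 0) x ∧ x 0 = x₀ ∧ ∀ t, 0 ≤ t → x t ∈ F

/-- `F` is directly reachable: some solution of the relaxed control system that starts outside
`F` converges to a point of the relative interior of `F`. -/
def IsDirectlyReachable (F : Set (Fin n → ℝ)) : Prop :=
  ∃ x : ℝ → Fin n → ℝ, IsRelaxedSolution L (Ici 0) x ∧ x 0 ∉ F ∧
    ∃ y ∈ intrinsicInterior ℝ F, Tendsto x atTop (𝓝 y)

/-- `F` is approximately reachable: the closure of the reachable set of some state outside `F`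
meets the relative interior of `F`. -/
def IsApproxReachable (F : Set (Fin n → ℝ)) : Prop :=
  ∃ x₀ ∈ stdSimplex ℝ (Fin n), x₀ ∉ F ∧
    (closure (reach L x₀) ∩ intrinsicInterior ℝ F).Nonempty

/-- `F` is purely Hamiltonian: every induced vector field `-L_U` whose restriction to `F` is
tangent to `F` vanishes on `F`. -/
def IsPurelyHamiltonianFace (F : Set (Fin n → ℝ)) : Prop :=
  ∀ U ∈ SUn n, (∀ x ∈ F, inducedField L U x ∈ vectorSpan ℝ F) →
    ∀ x ∈ F, inducedField L U x = 0

/-- Some (nonempty) face of dimension less than that of `simplexFace S` is approximately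
reachable. -/
def LowerFaceApproxReachable (S : Finset (Fin n)) : Prop :=
  ∃ T : Finset (Fin n), T.Nonempty ∧ T.card < S.card ∧ IsApproxReachable L (simplexFace T)

end ReducedSystem

end

/-! Only the transition rates J_ij(U) = ∑ₖ |(U* Vₖ U)_ij|² matter: `-L_U` is the master equation
field with these rates, and H₀ drops out. Endpoints of relaxed solutions lie in the closure of what
piecewise constant controls reach (`mem_closure_flowOrbit`), so every notion of reachability reduces
to closures of orbits of a semigroup of stochastic maps.

For the face F given by S, let out(U) and in(U) be the total rates of transitions leaving and
entering F. Then out(U) = 0 says that the span of the columns of U indexed by S is invariant under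
all Vₖ, and out(U) = in(U) = 0 says that it is reducing. Everything hinges on whether some U has
out(U) = 0 ≠ in(U) (`HasEnteringControl`). Permuting columns of U permutes the rates, so this
depends only on the dimension of F.

If such a U exists, averaging its permuted versions drives the barycenter of the opposite face to
the barycenter of F, and F is directly reachable. If none exists, perturbation of invariant
subspaces and compactness give in ≤ K · out (`exists_inRate_le_mul_outRate`). Then, near F, a state
whose coordinates in S all dominate K times the mass outside F cannot lose that mass, so F can only
be approached through its relative boundary, and a smaller face is approximately reachable.
Viability has a separate reason: if out(U) > 0 for all U, compactness bounds it below, and a barrier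
keeps every orbit that starts outside F away from the relative interior (`exists_outRate_eq_zero`).
This gives (ii) ⇒ (iii).

For (i) ⇒ (ii), descending through approximately reachable faces ends at a size for which an
entering control exists. A permutation places a face of this size inside F, its barycenter is then a
limit of an orbit starting outside F, and a transition inside F, available because F is not purely
Hamiltonian, fills the vanishing coordinates one at a time. -/

/-! ### Reduction to a master equation; symmetries of the rates. -/

/-- The transition rates `J_ij(U) = ∑ₖ |(U* Vₖ U)_ij|²`. -/
noncomputable def lindbladRate {n r : ℕ} (V : Fin r → CMat n) (U : CMat n) (i j : Fin n) : ℝ :=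
  ∑ k, Complex.normSq ((Uᴴ * V k * U) i j)

/-- The master equation vector field `x ↦ (∑ⱼ Jᵢⱼ xⱼ - (∑ⱼ Jⱼᵢ) xᵢ)ᵢ` with transition rates `J`. -/
noncomputable def rateField {n : ℕ} (J : Fin n → Fin n → ℝ) : (Fin n → ℝ) →L[ℝ] (Fin n → ℝ) :=
  LinearMap.toContinuousLinearMap
    (Matrix.toLin' (Matrix.of J - Matrix.diagonal fun j => ∑ l, J l j))

theorem rateField_apply {n : ℕ} (J : Fin n → Fin n → ℝ) (x : Fin n → ℝ) (i : Fin n) :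
    rateField J x i = ∑ j, J i j * x j - (∑ j, J j i) * x i := by
  change ((Matrix.of J - Matrix.diagonal fun j => ∑ l, J l j) *ᵥ x) i = _
  rw [Matrix.sub_mulVec, Pi.sub_apply, Matrix.mulVec_diagonal]
  rfl

theorem lindbladRate_nonneg {n r : ℕ} (V : Fin r → CMat n) (U : CMat n) (i j : Fin n) :
    0 ≤ lindbladRate V U i j :=
  Finset.sum_nonneg fun _ _ => Complex.normSq_nonneg _

theorem continuous_lindbladRate {n r : ℕ} (V : Fin r → CMat n) (i j : Fin n) :
    Continuous fun U => lindbladRate V U i j := by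
  unfold lindbladRate
  refine continuous_finsetSum _ fun k _ => Complex.continuous_normSq.comp ?_
  have : Continuous fun U : CMat n => Uᴴ * V k * U := by fun_prop
  exact this.matrix_elem i j

theorem continuous_rateField {n : ℕ} :
    Continuous (rateField : (Fin n → Fin n → ℝ) → ((Fin n → ℝ) →L[ℝ] (Fin n → ℝ))) := by
  have : (rateField : (Fin n → Fin n → ℝ) → ((Fin n → ℝ) →L[ℝ] (Fin n → ℝ))) =
      fun J => (LinearMap.toContinuousLinearMap.toLinearMap ∘ₗ Matrix.toLin'.toLinearMap :
        Matrix (Fin n) (Fin n) ℝ →ₗ[ℝ] _) (Matrix.of J - Matrix.diagonal fun j => ∑ l, J l j) := rfl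
  rw [this]
  refine (LinearMap.continuous_of_finiteDimensional _).comp ?_
  refine Continuous.sub continuous_id ?_
  exact Continuous.matrix_diagonal (by fun_prop)

theorem mem_SUn_iff {n : ℕ} {U : CMat n} : U ∈ SUn n ↔ Uᴴ * U = 1 ∧ U.det = 1 := by
  rw [SetLike.mem_coe, Matrix.mem_specialUnitaryGroup_iff, Matrix.mem_unitaryGroup_iff']
  rfl

/-- Conjugation by U replaces H₀ and Vₖ by U* H₀ U and U* Vₖ U. The commutator of any matrix with a
diagonal one has zero diagonal, so only the dissipators contribute, with the squared moduli of the
entries of U* Vₖ U as weights. -/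
theorem inducedField_eq_rateField {n r : ℕ} {L : CMat n → CMat n} {H₀ : CMat n}
    {V : Fin r → CMat n}
    (hL : ∀ ρ, L ρ = Complex.I • (H₀ * ρ - ρ * H₀) + ∑ k, dissipator (V k) ρ)
    {U : CMat n} (hU : U ∈ SUn n) (x : Fin n → ℝ) :
    inducedField L U x = rateField (lindbladRate V U) x := by
  have hU1 : Uᴴ * U = 1 := (mem_SUn_iff.1 hU).1
  have hU2 : U * Uᴴ = 1 := mul_eq_one_comm.1 hU1
  funext i
  rw [rateField_apply]
  set D : CMat n := Matrix.diagonal fun j => (x j : ℂ) with hD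
  have h1 : Uᴴ * L (U * D * Uᴴ) * U = Complex.I • ((Uᴴ * H₀ * U) * D - D * (Uᴴ * H₀ * U)) +
      ∑ k, dissipator (Uᴴ * V k * U) D := by
    rw [hL]
    simp only [mul_add, add_mul, Finset.mul_sum, Finset.sum_mul, mul_smul_comm, smul_mul_assoc,
      dissipator, mul_sub, sub_mul, Matrix.conjTranspose_mul, Matrix.conjTranspose_conjTranspose]
    have e1 : ∀ X : CMat n, Uᴴ * (U * X) = X := fun X => by rw [← mul_assoc, hU1, one_mul]
    have e2 : ∀ X : CMat n, U * (Uᴴ * X) = X := fun X => by rw [← mul_assoc, hU2, one_mul]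
    simp only [mul_assoc, e1, e2, hU1, mul_one]
  have h2 : ∀ k, (dissipator (Uᴴ * V k * U) D i i).re =
      (∑ j, Complex.normSq ((Uᴴ * V k * U) j i)) * x i -
        ∑ j, Complex.normSq ((Uᴴ * V k * U) i j) * x j := by
    intro k
    set W := Uᴴ * V k * U
    have e1 : (Wᴴ * W) i i = ((∑ j, Complex.normSq (W j i) : ℝ) : ℂ) := by
      rw [Matrix.mul_apply]
      push_cast
      refine Finset.sum_congr rfl fun j _ => ?_
      rw [Matrix.conjTranspose_apply, Complex.star_def, Complex.normSq_eq_conj_mul_self]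
    have e2 : (W * D * Wᴴ) i i = ((∑ j, Complex.normSq (W i j) * x j : ℝ) : ℂ) := by
      rw [Matrix.mul_apply]
      push_cast
      refine Finset.sum_congr rfl fun j _ => ?_
      rw [Matrix.conjTranspose_apply, Complex.star_def, Complex.normSq_eq_conj_mul_self, hD,
        Matrix.mul_diagonal]
      ring
    rw [dissipator, Matrix.sub_apply, Matrix.smul_apply, Matrix.add_apply, e2, hD,
      Matrix.mul_diagonal, Matrix.diagonal_mul, e1]
    rw [Complex.sub_re, Complex.ofReal_re]
    congr 1
    rw [mul_comm ((x i : ℝ) : ℂ), ← two_mul, smul_eq_mul, ← mul_assoc]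
    norm_num
  rw [inducedField, h1, Matrix.add_apply, Matrix.smul_apply, Matrix.sub_apply, hD,
    Matrix.mul_diagonal, Matrix.diagonal_mul, mul_comm ((x i : ℝ) : ℂ), sub_self, smul_zero,
    zero_add, ← hD, Matrix.sum_apply, Complex.re_sum, Finset.sum_congr rfl fun k _ => h2 k]
  simp only [lindbladRate, Finset.sum_sub_distrib, Finset.sum_mul]
  rw [Finset.sum_comm, neg_sub]
  congr 1
  rw [Finset.sum_comm]

/-- Since det U has modulus one, an n-th root of its conjugate is a phase that corrects the
determinant. Phases do not change the rates, so arbitrary unitary matrices may serve as controls. -/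
theorem exists_smul_mem_SUn {n : ℕ} {U : CMat n} (hU : Uᴴ * U = 1) :
    ∃ ω : ℂ, Complex.normSq ω = 1 ∧ ω • U ∈ SUn n := by
  have hdet : star U.det * U.det = 1 := by
    rw [← Matrix.det_conjTranspose, ← Matrix.det_mul, hU, Matrix.det_one]
  have hdet1 : ‖U.det‖ = 1 := by
    have : ‖U.det‖ * ‖U.det‖ = 1 := by
      have := congrArg norm hdet
      rwa [norm_mul, norm_star, norm_one] at this
    nlinarith [norm_nonneg U.det]
  rcases Nat.eq_zero_or_pos n with rfl | hn
  · exact ⟨1, by simp, mem_SUn_iff.2 ⟨by simpa using hU, by simp⟩⟩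
  obtain ⟨ω, hω⟩ := IsAlgClosed.exists_pow_nat_eq (star U.det) hn
  have hω1 : ‖ω‖ = 1 := by
    have : ‖ω‖ ^ n = 1 := by rw [← norm_pow, hω, norm_star, hdet1]
    exact (pow_eq_one_iff_of_nonneg (norm_nonneg _) hn.ne').1 this
  have hω2 : Complex.normSq ω = 1 := by rw [Complex.normSq_eq_norm_sq, hω1, one_pow]
  refine ⟨ω, hω2, mem_SUn_iff.2 ⟨?_, ?_⟩⟩
  · rw [Matrix.conjTranspose_smul, Matrix.smul_mul, Matrix.mul_smul, hU, smul_smul,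
      Complex.star_def, ← Complex.normSq_eq_conj_mul_self, hω2]
    simp
  · rw [Matrix.det_smul, Fintype.card_fin, hω, hdet]

theorem lindbladRate_smul {n r : ℕ} (V : Fin r → CMat n) {ω : ℂ} (hω : Complex.normSq ω = 1)
    (U : CMat n) : lindbladRate V (ω • U) = lindbladRate V U := by
  funext i j
  refine Finset.sum_congr rfl fun k _ => ?_
  rw [Matrix.conjTranspose_smul, Matrix.smul_mul, Matrix.smul_mul, Matrix.mul_smul, smul_smul,
    Complex.star_def, ← Complex.normSq_eq_conj_mul_self, hω]
  simp

theorem exists_mem_SUn_lindbladRate_eq {n r : ℕ} (V : Fin r → CMat n) {U : CMat n}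
    (hU : Uᴴ * U = 1) : ∃ U' ∈ SUn n, lindbladRate V U' = lindbladRate V U := by
  obtain ⟨ω, hω, h⟩ := exists_smul_mem_SUn hU
  exact ⟨_, h, lindbladRate_smul V hω U⟩

/-- Permuting the columns of U permutes rows and columns of U* Vₖ U simultaneously; a phase restores
determinant one. This symmetry makes faces of equal dimension interchangeable. -/
theorem exists_mem_SUn_lindbladRate_perm {n r : ℕ} (V : Fin r → CMat n) {U : CMat n}
    (hU : U ∈ SUn n) (σ : Equiv.Perm (Fin n)) :
    ∃ U' ∈ SUn n, ∀ i j, lindbladRate V U' i j = lindbladRate V U (σ i) (σ j) := by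
  have hU1 := (mem_SUn_iff.1 hU).1
  obtain ⟨U', hU', h⟩ := exists_mem_SUn_lindbladRate_eq V (U := U.submatrix id σ) (by
    rw [Matrix.conjTranspose_submatrix, ← Matrix.submatrix_mul _ _ _ _ _ Function.bijective_id,
      hU1, Matrix.submatrix_one_equiv])
  refine ⟨U', hU', fun i j => ?_⟩
  rw [h]
  rfl

theorem norm_entry_le_one_of_mem_SUn {n : ℕ} {U : CMat n} (hU : U ∈ SUn n) (i j : Fin n) :
    ‖U i j‖ ≤ 1 :=
  entry_norm_bound_of_unitary (Matrix.specialUnitaryGroup_le_unitaryGroup hU) i j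

theorem isCompact_SUn (n : ℕ) : IsCompact (SUn n) := by
  have hc : IsClosed (SUn n) := by
    have : SUn n = {U : CMat n | Uᴴ * U = 1} ∩ {U : CMat n | U.det = 1} := by
      ext U; exact mem_SUn_iff
    rw [this]
    exact (isClosed_eq (by fun_prop) continuous_const).inter
      (isClosed_eq (Continuous.matrix_det continuous_id) continuous_const)
  have hK : IsCompact (Set.univ.pi fun _ : Fin n => Set.univ.pi fun _ : Fin n =>
      Metric.closedBall (0 : ℂ) 1) :=
    isCompact_univ_pi fun _ => isCompact_univ_pi fun _ => isCompact_closedBall _ _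
  refine hK.of_isClosed_subset hc fun U hU => ?_
  simpa [Set.mem_pi] using norm_entry_le_one_of_mem_SUn hU

/-- The linear vector fields `-L_U`, `U ∈ SU(n)`. -/
def generators {n r : ℕ} (V : Fin r → CMat n) : Set ((Fin n → ℝ) →L[ℝ] (Fin n → ℝ)) :=
  (fun U => rateField (lindbladRate V U)) '' SUn n

theorem isCompact_generators {n r : ℕ} (V : Fin r → CMat n) : IsCompact (generators V) := by
  refine (isCompact_SUn n).image (continuous_rateField.comp ?_)
  exact continuous_pi fun i => continuous_pi fun j => continuous_lindbladRate V i j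

/-! ### Exponentials and stochastic maps. -/

open scoped Nat in
theorem norm_inv_factorial_smul_pow_le {A : Type*} [NormedRing A] [NormedAlgebra ℝ A] (a : A)
    {k : ℕ} (hk : 0 < k) :
    ‖((k ! : ℝ)⁻¹) • a ^ k‖ ≤ ((k ! : ℝ)⁻¹) • ‖a‖ ^ k := by
  rw [norm_smul, norm_inv, RCLike.norm_natCast, smul_eq_mul]
  exact mul_le_mul_of_nonneg_left (norm_pow_le' a hk) (by positivity)

section ExpBounds

variable {A : Type*} [NormedRing A] [NormedAlgebra ℝ A] [CompleteSpace A]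

/-- The series from its second-order term on is dominated termwise. Only positive powers occur, so
no bound on the norm of `1` is needed. -/
theorem norm_exp_sub_one_sub_le_exp (a : A) :
    ‖NormedSpace.exp a - 1 - a‖ ≤ Real.exp ‖a‖ - 1 - ‖a‖ := by
  have h1 := (hasSum_nat_add_iff' 2).2 (NormedSpace.exp_series_hasSum_exp' (𝕂 := ℝ) a)
  have h2 := (hasSum_nat_add_iff' 2).2 (NormedSpace.exp_series_hasSum_exp' (𝕂 := ℝ) ‖a‖)
  have := tsum_of_norm_bounded h2 fun k =>
    norm_inv_factorial_smul_pow_le a (Nat.succ_pos (k + 1))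
  rw [h1.tsum_eq] at this
  simpa [Finset.sum_range_succ, ← Real.exp_eq_exp_ℝ, sub_sub] using this

end ExpBounds

/-- A linear map that preserves positivity and the sum of the coordinates. -/
def IsStochasticMap {n : ℕ} (Φ : (Fin n → ℝ) →L[ℝ] (Fin n → ℝ)) : Prop :=
  (∀ x, 0 ≤ x → 0 ≤ Φ x) ∧ ∀ x, ∑ i, Φ x i = ∑ i, x i

namespace IsStochasticMap

variable {n : ℕ} {Φ Ψ : (Fin n → ℝ) →L[ℝ] (Fin n → ℝ)}

theorem one : IsStochasticMap (1 : (Fin n → ℝ) →L[ℝ] (Fin n → ℝ)) :=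
  ⟨fun _ h => h, fun _ => rfl⟩

theorem mul (hΦ : IsStochasticMap Φ) (hΨ : IsStochasticMap Ψ) : IsStochasticMap (Φ * Ψ) :=
  ⟨fun x hx => hΦ.1 _ (hΨ.1 x hx), fun x => (hΦ.2 _).trans (hΨ.2 x)⟩

theorem mem_stdSimplex (hΦ : IsStochasticMap Φ) {x : Fin n → ℝ}
    (hx : x ∈ stdSimplex ℝ (Fin n)) : Φ x ∈ stdSimplex ℝ (Fin n) :=
  ⟨hΦ.1 x hx.1, (hΦ.2 x).trans hx.2⟩

/-- Apply positivity to |x| ± x, then conservation of the sum to |x|. Because of this contraction in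
the ℓ¹ norm, discretization errors add up without being amplified by later steps. -/
theorem sum_abs_le (hΦ : IsStochasticMap Φ) (x : Fin n → ℝ) : ∑ i, |Φ x i| ≤ ∑ i, |x i| := by
  have h : ∀ i, |Φ x i| ≤ Φ |x| i := fun i => by
    have h1 := hΦ.1 (|x| - x) (sub_nonneg.2 (le_abs_self x)) i
    have h2 := hΦ.1 (|x| + x) (neg_le_iff_add_nonneg.1 (neg_le_abs x)) i
    rw [map_sub, Pi.zero_apply, Pi.sub_apply] at h1
    rw [map_add, Pi.zero_apply, Pi.add_apply] at h2
    exact abs_le.2 ⟨by linarith, by linarith⟩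
  exact (Finset.sum_le_sum fun i _ => h i).trans_eq (hΦ.2 |x|)

end IsStochasticMap

section Exponentials

variable {n : ℕ}

theorem exp_apply_nonneg {A : (Fin n → ℝ) →L[ℝ] (Fin n → ℝ)} (hA : ∀ x, 0 ≤ x → 0 ≤ A x)
    {x : Fin n → ℝ} (hx : 0 ≤ x) : 0 ≤ NormedSpace.exp A x := by
  have hpow : ∀ k : ℕ, 0 ≤ (A ^ k) x := fun k => by
    induction k with
    | zero => simpa using hx
    | succ k ih => rw [pow_succ']; exact hA _ ih
  intro i
  have h := NormedSpace.exp_series_hasSum_exp' (𝕂 := ℝ) A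
  have h' := (h.mapL (ContinuousLinearMap.apply ℝ (Fin n → ℝ) x)).mapL
    (ContinuousLinearMap.proj (R := ℝ) (φ := fun _ : Fin n => ℝ) i)
  refine h'.nonneg fun k => ?_
  exact mul_nonneg (by positivity) (hpow k i)

theorem sum_exp_apply {A : (Fin n → ℝ) →L[ℝ] (Fin n → ℝ)} (hA : ∀ x, ∑ i, A x i = 0)
    (x : Fin n → ℝ) : ∑ i, NormedSpace.exp A x i = ∑ i, x i := by
  have h := (NormedSpace.exp_series_hasSum_exp' (𝕂 := ℝ) A).mapL
    (ContinuousLinearMap.apply ℝ (Fin n → ℝ) x)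
  have h' := h.mapL (∑ i, ContinuousLinearMap.proj (R := ℝ) (φ := fun _ : Fin n => ℝ) i)
  have h0 := h'.unique (hasSum_single 0 fun k hk => by
    obtain ⟨k, rfl⟩ := Nat.exists_eq_succ_of_ne_zero hk
    simp only [pow_succ', map_smul, ContinuousLinearMap.apply_apply]
    have : (∑ i, ContinuousLinearMap.proj (R := ℝ) (φ := fun _ : Fin n => ℝ) i) ((A * A ^ k) x)
        = 0 := by
      simpa [sum_apply] using hA ((A ^ k) x)
    rw [Nat.succ_eq_add_one, this, smul_zero])
  simpa [sum_apply] using h0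

theorem sum_rateField_apply (J : Fin n → Fin n → ℝ) (x : Fin n → ℝ) :
    ∑ i, rateField J x i = 0 := by
  simp only [rateField_apply, Finset.sum_sub_distrib, Finset.sum_mul]
  rw [Finset.sum_comm, sub_self]

/-- The only negative coefficients of the field sit on the diagonal. Adding c times the identity,
with c the sum of all rates, makes them nonnegative, and since the identity commutes with everything
this costs only the positive factor exp(-tc). The sum is conserved because the columns of the field
sum to zero. -/
theorem isStochasticMap_exp_rateField {J : Fin n → Fin n → ℝ} (hJ : ∀ i j, 0 ≤ J i j) {t : ℝ}
    (ht : 0 ≤ t) : IsStochasticMap (NormedSpace.exp (t • rateField J)) := by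
  refine ⟨fun x hx => ?_, sum_exp_apply fun x => ?_⟩
  · set c : ℝ := ∑ i, ∑ j, J j i with hc
    have hdec : NormedSpace.exp (t • rateField J) =
        NormedSpace.exp (-(t * c)) •
          NormedSpace.exp (t • rateField J + (t * c) • (1 : (Fin n → ℝ) →L[ℝ] (Fin n → ℝ))) := by
      have h1 : t • rateField J = (-(t * c)) • (1 : (Fin n → ℝ) →L[ℝ] (Fin n → ℝ)) +
          (t • rateField J + (t * c) • (1 : (Fin n → ℝ) →L[ℝ] (Fin n → ℝ))) := by
        module
      conv_lhs => rw [h1]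
      let _ := NormedAlgebra.restrictScalars ℚ ℝ ((Fin n → ℝ) →L[ℝ] (Fin n → ℝ))
      rw [NormedSpace.exp_add_of_commute ((Commute.one_left _).smul_left _),
        ← Algebra.algebraMap_eq_smul_one, ← NormedSpace.algebraMap_exp_comm,
        Algebra.algebraMap_eq_smul_one, smul_one_mul]
    rw [hdec]
    refine smul_nonneg (a := NormedSpace.exp (-(t * c)))
      (by rw [← Real.exp_eq_exp_ℝ]; positivity) (exp_apply_nonneg ?_ hx)
    intro y hy i
    have h1 : ∑ j, J j i ≤ c :=
      Finset.single_le_sum (f := fun i => ∑ j, J j i)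
        (fun i _ => Finset.sum_nonneg fun j _ => hJ j i) (Finset.mem_univ i)
    have h2 : 0 ≤ ∑ j, J i j * y j := Finset.sum_nonneg fun j _ => mul_nonneg (hJ i j) (hy j)
    have h3 : (t • rateField J + (t * c) • (1 : (Fin n → ℝ) →L[ℝ] (Fin n → ℝ))) y i =
        t * (∑ j, J i j * y j + (c - ∑ j, J j i) * y i) := by
      simp only [add_apply, smul_apply, Pi.add_apply,
        Pi.smul_apply, rateField_apply, smul_eq_mul, one_apply_eq_self]
      ring
    rw [h3]
    exact mul_nonneg ht (add_nonneg h2 (mul_nonneg (sub_nonneg.2 h1) (hy i)))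
  · simp [← Finset.mul_sum, sum_rateField_apply]

end Exponentials

/-! ### The semigroup of piecewise constant controls. -/

section Flows

variable {n r : ℕ} (V : Fin r → CMat n)

/-- The semigroup of the flows of piecewise constant controls. -/
noncomputable def flows : Submonoid ((Fin n → ℝ) →L[ℝ] (Fin n → ℝ)) :=
  Submonoid.closure {Φ | ∃ t : ℝ, 0 ≤ t ∧ ∃ M ∈ generators V, Φ = NormedSpace.exp (t • M)}

/-- The states reachable from `x` by piecewise constant controls. -/
noncomputable def flowOrbit (x : Fin n → ℝ) : Set (Fin n → ℝ) :=
  (fun Φ => Φ x) '' (flows V : Set ((Fin n → ℝ) →L[ℝ] (Fin n → ℝ)))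

variable {V}

theorem exp_mem_flows {t : ℝ} (ht : 0 ≤ t) {M : (Fin n → ℝ) →L[ℝ] (Fin n → ℝ)}
    (hM : M ∈ generators V) : NormedSpace.exp (t • M) ∈ flows V :=
  Submonoid.subset_closure ⟨t, ht, M, hM, rfl⟩

theorem isStochasticMap_of_mem_flows {Φ : (Fin n → ℝ) →L[ℝ] (Fin n → ℝ)} (hΦ : Φ ∈ flows V) :
    IsStochasticMap Φ := by
  induction hΦ using Submonoid.closure_induction with
  | mem Φ h =>
    obtain ⟨t, ht, _, ⟨U, _, rfl⟩, rfl⟩ := h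
    exact isStochasticMap_exp_rateField (fun i j => lindbladRate_nonneg V U i j) ht
  | one => exact .one
  | mul _ _ _ _ h1 h2 => exact h1.mul h2

/-- The set of fields satisfying such an estimate for all h is convex: follow M₂ for time hb and
then M₁ for time ha. The error is written as exp(hC) - 1 - hC because this form reproduces itself
exactly under such compositions, so no constant deteriorates. -/
theorem exists_flow_of_mem_convexHull_generators {C : ℝ} (hC : ∀ M ∈ generators V, ‖M‖ ≤ C)
    {M : (Fin n → ℝ) →L[ℝ] (Fin n → ℝ)} (hM : M ∈ convexHull ℝ (generators V)) {h : ℝ}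
    (hh : 0 ≤ h) : ∃ Φ ∈ flows V, ‖Φ - 1 - h • M‖ ≤ Real.exp (h * C) - 1 - h * C := by
  have hC0 : 0 ≤ C := by
    obtain ⟨M₀, h₀⟩ := convexHull_nonempty_iff.1 ⟨M, hM⟩
    exact (norm_nonneg _).trans (hC M₀ h₀)
  have mono : ∀ {a b : ℝ}, 0 ≤ a → a ≤ b → Real.exp a - 1 - a ≤ Real.exp b - 1 - b := by
    intro a b ha hab
    have h1 := Real.add_one_le_exp (b - a)
    have h2 : Real.exp b = Real.exp a * Real.exp (b - a) := by rw [← Real.exp_add]; congr 1; ring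
    have h3 := Real.one_le_exp ha
    nlinarith
  suffices H : convexHull ℝ (generators V) ⊆ {M | ‖M‖ ≤ C ∧ ∀ h : ℝ, 0 ≤ h →
      ∃ Φ ∈ flows V, ‖Φ - 1 - h • M‖ ≤ Real.exp (h * C) - 1 - h * C} from (H hM).2 h hh
  refine convexHull_min (fun M hM => ⟨hC M hM, fun h hh => ⟨_, exp_mem_flows hh hM, ?_⟩⟩) ?_
  · refine (norm_exp_sub_one_sub_le_exp _).trans (mono (norm_nonneg _) ?_)
    rw [norm_smul, Real.norm_of_nonneg hh]
    exact mul_le_mul_of_nonneg_left (hC M hM) hh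
  · rintro M₁ ⟨hM₁, h₁⟩ M₂ ⟨hM₂, h₂⟩ a b ha hb hab
    refine ⟨?_, fun h hh => ?_⟩
    · refine (norm_add_le _ _).trans ?_
      rw [norm_smul, norm_smul, Real.norm_of_nonneg ha, Real.norm_of_nonneg hb]
      nlinarith
    obtain ⟨Φ₁, hΦ₁, e₁⟩ := h₁ (h * a) (mul_nonneg hh ha)
    obtain ⟨Φ₂, hΦ₂, e₂⟩ := h₂ (h * b) (mul_nonneg hh hb)
    refine ⟨Φ₁ * Φ₂, mul_mem hΦ₁ hΦ₂, ?_⟩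
    set α := h * a * C with hα
    set β := h * b * C with hβ
    have hα0 : 0 ≤ α := by positivity
    have hβ0 : 0 ≤ β := by positivity
    have hA : ‖(h * a) • M₁‖ ≤ α := by
      rw [norm_smul, Real.norm_of_nonneg (by positivity)]
      exact mul_le_mul_of_nonneg_left hM₁ (by positivity)
    have hB : ‖(h * b) • M₂‖ ≤ β := by
      rw [norm_smul, Real.norm_of_nonneg (by positivity)]
      exact mul_le_mul_of_nonneg_left hM₂ (by positivity)
    have hΦ₁1 : ‖Φ₁ - 1‖ ≤ Real.exp α - 1 := by
      calc ‖Φ₁ - 1‖ = ‖(Φ₁ - 1 - (h * a) • M₁) + (h * a) • M₁‖ := by rw [sub_add_cancel]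
        _ ≤ _ := (norm_add_le _ _).trans (by linarith)
    have hΦ₁0 : ‖Φ₁‖ ≤ Real.exp α := by
      calc ‖Φ₁‖ = ‖(Φ₁ - 1) + 1‖ := by rw [sub_add_cancel]
        _ ≤ ‖Φ₁ - 1‖ + ‖(1 : (Fin n → ℝ) →L[ℝ] (Fin n → ℝ))‖ := norm_add_le _ _
        _ ≤ (Real.exp α - 1) + 1 := add_le_add hΦ₁1 ContinuousLinearMap.norm_id_le
        _ = _ := sub_add_cancel _ _
    -- The three terms are bounded by e^α (e^β - 1 - β), e^α - 1 - α and (e^α - 1) β, whose sum is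
    -- exactly e^(α+β) - 1 - (α + β).
    have hsplit : Φ₁ * Φ₂ - 1 - h • (a • M₁ + b • M₂) =
        Φ₁ * (Φ₂ - 1 - (h * b) • M₂) + (Φ₁ - 1 - (h * a) • M₁) + (Φ₁ - 1) * ((h * b) • M₂) := by
      simp only [mul_sub, sub_mul, smul_add, smul_smul, mul_one, one_mul]
      abel
    have hexp : Real.exp (h * C) = Real.exp α * Real.exp β := by
      rw [← Real.exp_add, hα, hβ]; congr 1; linear_combination (-h * C) * hab
    have hsum : h * C = α + β := by rw [hα, hβ]; linear_combination (-h * C) * hab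
    rw [hsplit, hexp, hsum]
    calc _ ≤ ‖Φ₁‖ * ‖Φ₂ - 1 - (h * b) • M₂‖ + ‖Φ₁ - 1 - (h * a) • M₁‖ +
          ‖Φ₁ - 1‖ * ‖(h * b) • M₂‖ :=
          (norm_add_le _ _).trans (add_le_add ((norm_add_le _ _).trans
            (add_le_add (norm_mul_le _ _) le_rfl)) (norm_mul_le _ _))
      _ ≤ Real.exp α * (Real.exp β - 1 - β) + (Real.exp α - 1 - α) + (Real.exp α - 1) * β := by
          gcongr
          exact (norm_nonneg _).trans hΦ₁1
      _ = _ := by ring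

end Flows

/-! ### Absolutely continuous paths with values in ℝⁿ. -/

section AbsolutelyContinuous

variable {n : ℕ}

theorem AbsolutelyContinuousOnInterval.eval {x : ℝ → Fin n → ℝ} {a b : ℝ}
    (hx : AbsolutelyContinuousOnInterval x a b) (i : Fin n) :
    AbsolutelyContinuousOnInterval (fun t => x t i) a b := by
  rw [absolutelyContinuousOnInterval_iff] at hx ⊢
  intro ε hε
  obtain ⟨δ, hδ, h⟩ := hx ε hε
  refine ⟨δ, hδ, fun E hE hEδ => lt_of_le_of_lt ?_ (h E hE hEδ)⟩
  exact Finset.sum_le_sum fun j _ => dist_le_pi_dist _ _ i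

theorem AbsolutelyContinuousOnInterval.setIntegral_deriv_eq_sub_pi {x : ℝ → Fin n → ℝ} {a b : ℝ}
    (hab : a ≤ b) (hx : AbsolutelyContinuousOnInterval x a b)
    (hd : ∀ᵐ t ∂volume.restrict (Ioc a b), DifferentiableAt ℝ x t) :
    IntegrableOn (deriv x) (Ioc a b) ∧ ∫ t in Ioc a b, deriv x t = x b - x a := by
  have hi : ∀ i, (fun t => deriv (fun s => x s i) t) =ᵐ[volume.restrict (Ioc a b)]
      fun t => deriv x t i := fun i => by
    filter_upwards [hd] with t ht
    exact (hasDerivAt_pi.1 ht.hasDerivAt i).deriv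
  have hint : ∀ i, IntegrableOn (fun t => deriv x t i) (Ioc a b) := fun i =>
    ((hx.eval i).intervalIntegrable_deriv.1).congr (hi i)
  refine ⟨Integrable.of_eval hint, ?_⟩
  funext i
  rw [eval_integral hint, ← integral_congr_ae (hi i), ← intervalIntegral.integral_of_le hab,
    (hx.eval i).integral_deriv_eq_sub]
  rfl

theorem norm_le_one_of_mem_stdSimplex {x : Fin n → ℝ} (hx : x ∈ stdSimplex ℝ (Fin n)) :
    ‖x‖ ≤ 1 := by
  refine (pi_norm_le_iff_of_nonneg zero_le_one).2 fun i => ?_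
  rw [Real.norm_of_nonneg (hx.1 i), ← hx.2]
  exact Finset.single_le_sum (fun j _ => hx.1 j) (Finset.mem_univ i)

end AbsolutelyContinuous

/-! ### Approximation of relaxed solutions by piecewise constant controls. -/

section Relaxation

variable {n r : ℕ} {V : Fin r → CMat n}

theorem norm_le_of_mem_convexHull_generators {C : ℝ} (hC : ∀ M ∈ generators V, ‖M‖ ≤ C)
    {M : (Fin n → ℝ) →L[ℝ] (Fin n → ℝ)} (hM : M ∈ convexHull ℝ (generators V)) : ‖M‖ ≤ C := by
  have h : convexHull ℝ (generators V) ⊆ Metric.closedBall 0 C :=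
    convexHull_min (fun M hM => by simpa using hC M hM) (convex_closedBall _ _)
  simpa using h hM

/-- The path is C-Lipschitz from a, so almost every derivative lies within C² (b - a) of the convex
set of all M (x a). The closed thickening of a convex set is convex, hence contains the average of
the derivative, which is the difference quotient. -/
theorem exists_convexHull_generators_increment {C : ℝ} (hC : ∀ M ∈ generators V, ‖M‖ ≤ C)
    {x : ℝ → Fin n → ℝ} {a b : ℝ} (hab : a < b) (hx : AbsolutelyContinuousOnInterval x a b)
    (hx1 : ∀ t ∈ Icc a b, ‖x t‖ ≤ 1)
    (hd : ∀ᵐ t ∂volume.restrict (Icc a b),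
      ∃ M ∈ convexHull ℝ (generators V), HasDerivAt x (M (x t)) t) :
    ∃ M ∈ convexHull ℝ (generators V),
      ‖x b - x a - (b - a) • M (x a)‖ ≤ (C ^ 2 + 1) * (b - a) ^ 2 := by
  have hd' : ∀ {s}, s ∈ Icc a b → ∀ᵐ t ∂volume.restrict (Ioc a s),
      ∃ M ∈ convexHull ℝ (generators V), HasDerivAt x (M (x t)) t := fun {s} hs =>
    ae_restrict_of_ae_restrict_of_subset
      (Ioc_subset_Icc_self.trans (Icc_subset_Icc le_rfl hs.2)) hd
  have hb : b ∈ Icc a b := right_mem_Icc.2 hab.le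
  have ha : a ∈ Icc a b := left_mem_Icc.2 hab.le
  have hC0 : 0 ≤ C := by
    have : (volume.restrict (Ioc a b)) ≠ 0 := by
      rw [Ne, Measure.restrict_eq_zero, Real.volume_Ioc, ENNReal.ofReal_eq_zero]
      linarith
    have : (ae (volume.restrict (Ioc a b))).NeBot := ae_neBot.2 this
    obtain ⟨t, M, hM, -⟩ := (hd' hb).exists
    exact (norm_nonneg _).trans (norm_le_of_mem_convexHull_generators hC hM)
  have hlip : ∀ s ∈ Icc a b, ‖x s - x a‖ ≤ C * (s - a) := by
    intro s hs
    have hac : AbsolutelyContinuousOnInterval x a s := hx.mono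
      (uIcc_subset_uIcc left_mem_uIcc (by rwa [uIcc_of_le hab.le]))
    have := (hac.setIntegral_deriv_eq_sub_pi hs.1
      ((hd' hs).mono fun t ⟨M, _, h⟩ => h.differentiableAt)).2
    rw [← this]
    have hle := norm_setIntegral_le_of_norm_le_const_ae (μ := volume) (s := Ioc a s) (C := C)
      (f := deriv x) (by rw [Real.volume_Ioc]; exact ENNReal.ofReal_lt_top) ?_
    · rwa [measureReal_def, Real.volume_Ioc, ENNReal.toReal_ofReal (by linarith [hs.1])] at hle
    · have hmem : ∀ᵐ t ∂volume.restrict (Ioc a s), t ∈ Ioc a s :=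
        ae_restrict_mem measurableSet_Ioc
      filter_upwards [hd' hs, hmem] with t ⟨M, hM, h⟩ ht
      rw [h.deriv]
      calc ‖M (x t)‖ ≤ ‖M‖ * ‖x t‖ := M.le_opNorm _
        _ ≤ C * 1 := by
          gcongr
          · exact norm_le_of_mem_convexHull_generators hC hM
          · exact hx1 t ⟨ht.1.le, ht.2.trans hs.2⟩
        _ = C := mul_one C
  set A : Set (Fin n → ℝ) :=
    ContinuousLinearMap.apply ℝ (Fin n → ℝ) (x a) '' convexHull ℝ (generators V) with hA
  have hAconv : Convex ℝ A :=
    (convex_convexHull ℝ _).linear_image (ContinuousLinearMap.apply ℝ (Fin n → ℝ) (x a)).toLinearMap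
  set δ := C ^ 2 * (b - a) with hδ
  have hint := hx.setIntegral_deriv_eq_sub_pi hab.le
    ((hd' hb).mono fun t ⟨M, _, h⟩ => h.differentiableAt)
  have hmem : ∀ᵐ t ∂volume.restrict (Ioc a b), deriv x t ∈ Metric.cthickening δ A := by
    have hmem : ∀ᵐ t ∂volume.restrict (Ioc a b), t ∈ Ioc a b := ae_restrict_mem measurableSet_Ioc
    filter_upwards [hd' hb, hmem] with t ⟨M, hM, h⟩ ht
    rw [h.deriv]
    refine Metric.mem_cthickening_of_dist_le _ (M (x a)) _ _ ⟨M, hM, rfl⟩ ?_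
    rw [dist_eq_norm, ← map_sub]
    calc ‖M (x t - x a)‖ ≤ ‖M‖ * ‖x t - x a‖ := M.le_opNorm _
      _ ≤ C * (C * (t - a)) := by
        gcongr
        · exact norm_le_of_mem_convexHull_generators hC hM
        · exact hlip t ⟨ht.1.le, ht.2⟩
      _ ≤ δ := by rw [hδ, sq, mul_assoc]; gcongr; exact ht.2
  have havg := (hAconv.cthickening δ).set_average_mem Metric.isClosed_cthickening
    (by rw [Real.volume_Ioc, Ne, ENNReal.ofReal_eq_zero]; linarith)
    (by rw [Real.volume_Ioc]; exact ENNReal.ofReal_ne_top) hmem hint.1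
  rw [setAverage_eq, hint.2, measureReal_def, Real.volume_Ioc,
    ENNReal.toReal_ofReal (by linarith)] at havg
  -- The constant C² + 1 in place of C² leaves room to pass to an open thickening, whose points are
  -- close to an actual element of A even though A is not known to be closed.
  have hthick := Metric.cthickening_subset_thickening' (δ₁ := δ) (δ₂ := (C ^ 2 + 1) * (b - a))
    (by nlinarith) (by rw [hδ]; nlinarith) A havg
  obtain ⟨_, ⟨M, hM, rfl⟩, hdist⟩ := Metric.mem_thickening_iff.1 hthick
  refine ⟨M, hM, ?_⟩
  have hba : 0 < b - a := sub_pos.2 hab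
  have : x b - x a - (b - a) • M (x a) =
      (b - a) • ((b - a)⁻¹ • (x b - x a) - M (x a)) := by
    rw [smul_sub, smul_smul, mul_inv_cancel₀ hba.ne', one_smul]
  rw [this, norm_smul, Real.norm_of_nonneg hba.le, ← dist_eq_norm]
  calc (b - a) * _ ≤ (b - a) * ((C ^ 2 + 1) * (b - a)) := by gcongr; exact hdist.le
    _ = _ := by ring

/-- Solutions of the relaxed system are approximated by flows of piecewise constant controls. -/
theorem mem_closure_flowOrbit {x : ℝ → Fin n → ℝ} {T : ℝ} (hT : 0 ≤ T)
    (hx : AbsolutelyContinuousOnInterval x 0 T)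
    (hx1 : ∀ t ∈ Icc 0 T, x t ∈ stdSimplex ℝ (Fin n))
    (hd : ∀ᵐ t ∂volume.restrict (Icc 0 T),
      ∃ M ∈ convexHull ℝ (generators V), HasDerivAt x (M (x t)) t) :
    x T ∈ closure (flowOrbit V (x 0)) := by
  rcases hT.eq_or_lt with rfl | hT
  · exact subset_closure ⟨1, one_mem _, rfl⟩
  obtain ⟨C, hC⟩ := (isCompact_generators V).isBounded.exists_norm_le
  have hC0 : 0 ≤ C := by
    have : (volume.restrict (Icc 0 T)) ≠ 0 := by
      rw [Ne, Measure.restrict_eq_zero, Real.volume_Icc, ENNReal.ofReal_eq_zero]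
      linarith
    have : (ae (volume.restrict (Icc 0 T))).NeBot := ae_neBot.2 this
    obtain ⟨t, M, hM, -⟩ := hd.exists
    exact (norm_nonneg _).trans (norm_le_of_mem_convexHull_generators hC hM)
  -- One step of length h costs (C² + 1) h² for freezing the state and C² h² for replacing a convex
  -- combination by a flow, the latter using hC ≤ 1. The factor n passes from the sup norm to the ℓ¹
  -- norm.
  set K : ℝ := n * (2 * C ^ 2 + 1) with hK
  have key : ∀ N : ℕ, T * C ≤ N → 0 < N →
      ∃ Φ ∈ flows V, ∑ i, |(x T - Φ (x 0)) i| ≤ N * (K * (T / N) ^ 2) := by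
    intro N hN hN0
    have hN0' : (0 : ℝ) < N := by exact_mod_cast hN0
    set h : ℝ := T / N with hh
    have hh0 : 0 < h := by positivity
    have hNh : N * h = T := by rw [hh]; field_simp
    have hhC : h * C ≤ 1 := by rw [hh, div_mul_eq_mul_div, div_le_one hN0']; exact hN
    -- Flows contract the ℓ¹ norm, so earlier errors are carried along unchanged and the total after
    -- N steps is at most N K h² = K T² / N.
    have step : ∀ k : ℕ, k ≤ N →
        ∃ Φ ∈ flows V, ∑ i, |(x (k * h) - Φ (x 0)) i| ≤ k * (K * h ^ 2) := by
      intro k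
      induction k with
      | zero => exact fun _ => ⟨1, one_mem _, by simp⟩
      | succ k ih =>
        intro hk
        obtain ⟨Φ, hΦ, hle⟩ := ih (Nat.le_of_succ_le hk)
        have hk0 : 0 ≤ k * h := by positivity
        have hk1 : ((k + 1 : ℕ) : ℝ) * h ≤ T := by
          rw [← hNh]; gcongr
        have hlt : k * h < ((k + 1 : ℕ) : ℝ) * h := by push_cast; nlinarith
        have hsub : Icc (k * h) (((k + 1 : ℕ) : ℝ) * h) ⊆ Icc 0 T := Icc_subset_Icc hk0 hk1
        obtain ⟨M, hM, hinc⟩ := exists_convexHull_generators_increment hC hlt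
          (hx.mono (by rwa [uIcc_of_le hT.le, uIcc_of_le hlt.le]))
          (fun t ht => norm_le_one_of_mem_stdSimplex (hx1 t (hsub ht)))
          (ae_restrict_of_ae_restrict_of_subset hsub hd)
        have hdiff : ((k + 1 : ℕ) : ℝ) * h - k * h = h := by push_cast; ring
        rw [hdiff] at hinc
        obtain ⟨Ψ, hΨ, hΨe⟩ := exists_flow_of_mem_convexHull_generators hC hM hh0.le
        have hexp : Real.exp (h * C) - 1 - h * C ≤ C ^ 2 * h ^ 2 := by
          have := Real.abs_exp_sub_one_sub_id_le (x := h * C)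
            (by rw [abs_of_nonneg (by positivity)]; exact hhC)
          calc _ ≤ (h * C) ^ 2 := (le_abs_self _).trans this
            _ = _ := by ring
        set y := x (k * h) with hy
        have hy1 : ‖y‖ ≤ 1 := norm_le_one_of_mem_stdSimplex (hx1 _ (hsub (left_mem_Icc.2 hlt.le)))
        set z := x (((k + 1 : ℕ) : ℝ) * h) - Ψ y with hz
        have hznorm : ‖z‖ ≤ (2 * C ^ 2 + 1) * h ^ 2 := by
          have hsplit : z = (x (((k + 1 : ℕ) : ℝ) * h) - y - h • M y) - (Ψ - 1 - h • M) y := by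
            simp only [hz, sub_apply, smul_apply, one_apply_eq_self]
            abel
          rw [hsplit]
          calc _ ≤ _ := norm_sub_le _ _
            _ ≤ (C ^ 2 + 1) * h ^ 2 + C ^ 2 * h ^ 2 * 1 := by
              gcongr
              refine ((Ψ - 1 - h • M).le_opNorm y).trans ?_
              gcongr
              exact hΨe.trans hexp
            _ = _ := by ring
        refine ⟨Ψ * Φ, mul_mem hΨ hΦ, ?_⟩
        have hsplit : ∀ i, (x (((k + 1 : ℕ) : ℝ) * h) - (Ψ * Φ) (x 0)) i =
            z i + Ψ (y - Φ (x 0)) i := fun i => by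
          simp only [hz, map_sub, Pi.sub_apply, mul_apply_eq_comp]
          ring
        calc _ = ∑ i, |z i + Ψ (y - Φ (x 0)) i| := by simp_rw [hsplit]
          _ ≤ ∑ i, |z i| + ∑ i, |Ψ (y - Φ (x 0)) i| := by
            rw [← Finset.sum_add_distrib]
            exact Finset.sum_le_sum fun i _ => abs_add_le _ _
          _ ≤ ∑ _i : Fin n, (2 * C ^ 2 + 1) * h ^ 2 + k * (K * h ^ 2) := by
            refine add_le_add (Finset.sum_le_sum fun i _ => ?_)
              (((isStochasticMap_of_mem_flows hΨ).sum_abs_le _).trans hle)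
            exact (norm_le_pi_norm z i).trans hznorm
          _ = _ := by
            rw [Finset.sum_const, Finset.card_univ, Fintype.card_fin, nsmul_eq_mul, hK]
            push_cast
            ring
    obtain ⟨Φ, hΦ, hle⟩ := step N le_rfl
    rw [hNh] at hle
    exact ⟨Φ, hΦ, hle⟩
  rw [Metric.mem_closure_iff]
  intro ε hε
  obtain ⟨N, hN⟩ := exists_nat_gt (max (max (T * C) 0) (K * T ^ 2 / ε))
  have hN1 : T * C < N := (le_max_left _ _).trans_lt ((le_max_left _ _).trans_lt hN)
  have hN2 : (0 : ℝ) < N := (le_max_right _ _).trans_lt ((le_max_left _ _).trans_lt hN)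
  have hN3 : K * T ^ 2 / ε < N := (le_max_right _ _).trans_lt hN
  obtain ⟨Φ, hΦ, hle⟩ := key N hN1.le (by exact_mod_cast hN2)
  refine ⟨Φ (x 0), ⟨Φ, hΦ, rfl⟩, ?_⟩
  have hlt : N * (K * (T / N) ^ 2) < ε := by
    rw [div_lt_iff₀ hε] at hN3
    have : N * (K * (T / N) ^ 2) = K * T ^ 2 / N := by field_simp
    rw [this, div_lt_iff₀ hN2]
    linarith
  rw [dist_eq_norm]
  refine lt_of_le_of_lt ((pi_norm_le_iff_of_nonneg ?_).2 fun i => ?_) hlt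
  · exact (Finset.sum_nonneg fun i _ => abs_nonneg _).trans hle
  · exact (Finset.single_le_sum (f := fun i => |(x T - Φ (x 0)) i|)
      (fun j _ => abs_nonneg _) (Finset.mem_univ i)).trans hle

end Relaxation

/-! ### Paths generated by a constant control. -/

section Paths

variable {n : ℕ}

theorem absContOn_of_norm_hasDerivAt_le {I : Set ℝ} (hI : I.OrdConnected)
    {x x' : ℝ → Fin n → ℝ} {C : ℝ} (hx : ∀ t ∈ I, HasDerivAt x (x' t) t)
    (hC : ∀ t ∈ I, ‖x' t‖ ≤ C) : AbsContOn I x := by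
  intro a ha b hb
  have hsub : uIcc a b ⊆ I := hI.uIcc_subset ha hb
  refine LipschitzOnWith.absolutelyContinuousOnInterval (K := C.toNNReal) ?_
  refine (convex_uIcc a b).lipschitzOnWith_of_nnnorm_hasDerivWithin_le
    (fun t ht => (hx t (hsub ht)).hasDerivWithinAt) fun t ht => ?_
  exact NNReal.le_toNNReal_of_coe_le (hC t (hsub ht))

theorem hasDerivAt_exp_smul_apply (M : (Fin n → ℝ) →L[ℝ] (Fin n → ℝ)) (y : Fin n → ℝ) (t : ℝ) :
    HasDerivAt (fun s : ℝ => NormedSpace.exp (s • M) y) (M (NormedSpace.exp (t • M) y)) t :=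
  by
  have h : HasDerivAt (fun s : ℝ => NormedSpace.exp (s • M)) (M * NormedSpace.exp (t • M)) t :=
    hasDerivAt_exp_smul_const' M t
  exact (ContinuousLinearMap.apply ℝ (Fin n → ℝ) y).hasFDerivAt.comp_hasDerivAt t h

end Paths

/-! ### Reachable sets as orbits of the flow semigroup. -/

section Reachability

variable {n r : ℕ} {V : Fin r → CMat n}

/-- The reduced control system of `L` is described by the transition rates of the terms `V`. -/
def HasRates {n r : ℕ} (L : CMat n → CMat n) (V : Fin r → CMat n) : Prop :=
  ∀ U ∈ SUn n, ∀ x, inducedField L U x = rateField (lindbladRate V U) x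

theorem exists_hasRates {L : CMat n → CMat n} (hL : -L ∈ KossakowskiLindblad n) :
    ∃ (r : ℕ) (V : Fin r → CMat n), HasRates L V := by
  obtain ⟨r, H₀, V, -, h⟩ := hL
  exact ⟨r, V, fun U hU x => inducedField_eq_rateField (fun ρ => neg_injective (h ρ)) hU x⟩

theorem HasRates.derv_eq {L : CMat n → CMat n} (hD : HasRates L V) (x : Fin n → ℝ) :
    derv L x = (fun M => M x) '' generators V := by
  rw [generators, Set.image_image]
  exact Set.image_congr fun U hU => hD U hU x

theorem HasRates.convexHull_derv_eq {L : CMat n → CMat n} (hD : HasRates L V) (x : Fin n → ℝ) :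
    convexHull ℝ (derv L x) = (fun M => M x) '' convexHull ℝ (generators V) := by
  rw [hD.derv_eq]
  exact ((ContinuousLinearMap.apply ℝ (Fin n → ℝ) x).toLinearMap.image_convexHull _).symm

theorem flow_apply_mem_stdSimplex {Φ : (Fin n → ℝ) →L[ℝ] (Fin n → ℝ)} (hΦ : Φ ∈ flows V)
    {x : Fin n → ℝ} (hx : x ∈ stdSimplex ℝ (Fin n)) : Φ x ∈ stdSimplex ℝ (Fin n) :=
  (isStochasticMap_of_mem_flows hΦ).mem_stdSimplex hx

theorem closure_flowOrbit_subset_stdSimplex {x : Fin n → ℝ} (hx : x ∈ stdSimplex ℝ (Fin n)) :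
    closure (flowOrbit V x) ⊆ stdSimplex ℝ (Fin n) := by
  refine closure_minimal ?_ (isClosed_stdSimplex ℝ _)
  rintro _ ⟨Φ, hΦ, rfl⟩
  exact flow_apply_mem_stdSimplex hΦ hx

theorem flow_apply_mem_closure_flowOrbit {x y : Fin n → ℝ} (hy : y ∈ closure (flowOrbit V x))
    {Φ : (Fin n → ℝ) →L[ℝ] (Fin n → ℝ)} (hΦ : Φ ∈ flows V) :
    Φ y ∈ closure (flowOrbit V x) := by
  refine map_mem_closure Φ.continuous hy ?_
  rintro _ ⟨Ψ, hΨ, rfl⟩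
  exact ⟨Φ * Ψ, mul_mem hΦ hΨ, rfl⟩

/-- Induction on the product of exponentials, each new factor extending the path at its end. A
common Lipschitz constant is carried because it survives concatenation and yields absolute
continuity. -/
theorem exists_lipschitz_path_of_mem_flows {L : CMat n → CMat n} (hD : HasRates L V) {C : NNReal}
    (hC : ∀ M ∈ generators V, ‖M‖ ≤ C) {x : Fin n → ℝ} (hx : x ∈ stdSimplex ℝ (Fin n))
    {Φ : (Fin n → ℝ) →L[ℝ] (Fin n → ℝ)} (hΦ : Φ ∈ flows V) :
    ∃ T : ℝ, 0 ≤ T ∧ ∃ p : ℝ → Fin n → ℝ, (∀ t ∈ Icc 0 T, p t ∈ stdSimplex ℝ (Fin n)) ∧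
      LipschitzOnWith C p (Icc 0 T) ∧ p 0 = x ∧ p T = Φ x ∧
      ∃ U : ℝ → CMat n, (∀ i j, Measurable fun t => U t i j) ∧ (∀ t, U t ∈ SUn n) ∧
        ∀ᵐ t ∂(volume.restrict (Icc 0 T)), HasDerivAt p (inducedField L (U t) (p t)) t := by
  induction hΦ using Submonoid.closure_induction_left with
  | one =>
    refine ⟨0, le_rfl, fun _ => x, fun _ _ => hx, LipschitzOnWith.of_dist_le_mul (by simp),
      rfl, rfl, fun _ => 1, fun i j => measurable_const, fun _ => one_mem _, ?_⟩
    rw [Icc_self, Measure.restrict_singleton, Real.volume_singleton, zero_smul, ae_zero]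
    exact eventually_bot
  | mul_left Ψ hΨ Φ hΦ ih =>
    obtain ⟨T, hT, p, hpΔ, hpL, hp0, hpT, U, hUm, hU, hpd⟩ := ih
    obtain ⟨τ, hτ, _, ⟨U₀, hU₀, rfl⟩, rfl⟩ := hΨ
    set M := rateField (lindbladRate V U₀) with hM
    have hMg : M ∈ generators V := ⟨U₀, hU₀, rfl⟩
    set e : ℝ → Fin n → ℝ := fun s => NormedSpace.exp ((s - T) • M) (p T) with he
    have heT : e T = p T := by simp [he]
    have hed : ∀ s, HasDerivAt e (M (e s)) s := fun s =>
      (hasDerivAt_exp_smul_apply M (p T) (s - T)).comp_sub_const s T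
    have heΔ : ∀ s, T ≤ s → e s ∈ stdSimplex ℝ (Fin n) := fun s hs =>
      flow_apply_mem_stdSimplex (exp_mem_flows (sub_nonneg.2 hs) hMg)
        (hpΔ T (right_mem_Icc.2 hT))
    have heL : LipschitzOnWith C e (Ici T) := by
      refine (convex_Ici T).lipschitzOnWith_of_nnnorm_hasDerivWithin_le
        (fun t _ => (hed t).hasDerivWithinAt) fun t ht => ?_
      rw [← NNReal.coe_le_coe, coe_nnnorm]
      calc ‖M (e t)‖ ≤ ‖M‖ * ‖e t‖ := M.le_opNorm _
        _ ≤ C * 1 := by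
          gcongr
          · exact hC M hMg
          · exact norm_le_one_of_mem_stdSimplex (heΔ t ht)
        _ = C := mul_one _
    set q : ℝ → Fin n → ℝ := fun s => if s ≤ T then p s else e s with hq
    have hq1 : ∀ s, s ≤ T → q s = p s := fun s hs => if_pos hs
    have hq2 : ∀ s, T ≤ s → q s = e s := fun s hs => by
      rcases hs.eq_or_lt with rfl | h
      · rw [hq1 _ le_rfl, heT]
      · exact if_neg (not_le.2 h)
    have hTτ : T ≤ T + τ := by linarith
    refine ⟨T + τ, by linarith, q, fun t ht => ?_, ?_, ?_, ?_,
      fun s => if s ≤ T then U s else U₀, ?_, ?_, ?_⟩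
    · rcases le_total t T with h | h
      · rw [hq1 t h]; exact hpΔ t ⟨ht.1, h⟩
      · rw [hq2 t h]; exact heΔ t h
    · have hmono : ∀ s ∈ Icc 0 (T + τ), ∀ t ∈ Icc 0 (T + τ), s ≤ t →
          dist (q s) (q t) ≤ C * dist s t := by
        intro s hs t ht hst
        rcases le_total t T with h | h
        · rw [hq1 t h, hq1 s (hst.trans h)]
          exact hpL.dist_le_mul s ⟨hs.1, hst.trans h⟩ t ⟨ht.1, h⟩
        rcases le_total s T with h' | h'
        · rw [hq1 s h', hq2 t h]
          have h1 := hpL.dist_le_mul s ⟨hs.1, h'⟩ T (right_mem_Icc.2 hT)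
          have h2 := heL.dist_le_mul T self_mem_Ici t h
          rw [heT] at h2
          have h3 : dist s t = dist s T + dist T t := by
            rw [Real.dist_eq, Real.dist_eq, Real.dist_eq, abs_of_nonpos (by linarith),
              abs_of_nonpos (by linarith), abs_of_nonpos (by linarith)]
            ring
          rw [h3, mul_add]
          exact (dist_triangle _ _ _).trans (add_le_add h1 h2)
        · rw [hq2 t h, hq2 s h']
          exact heL.dist_le_mul s h' t h
      refine LipschitzOnWith.of_dist_le_mul fun s hs t ht => ?_
      rcases le_total s t with h | h
      · exact hmono s hs t ht h
      · rw [dist_comm, dist_comm s]; exact hmono t ht s hs h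
    · rw [hq1 0 hT, hp0]
    · rw [hq2 _ hTτ, he]
      simp only [add_sub_cancel_left, hpT]
      rfl
    · intro i j
      have : (fun t => (if t ≤ T then U t else U₀) i j) =
          fun t => if t ≤ T then U t i j else U₀ i j := by
        funext t; split_ifs <;> rfl
      rw [this]
      exact Measurable.ite measurableSet_Iic (hUm i j) measurable_const
    · intro t
      dsimp only
      split_ifs
      exacts [hU t, hU₀]
    · rw [ae_restrict_iff' measurableSet_Icc] at hpd ⊢
      -- At the switching time the path may fail to be differentiable; a single point is negligible.
      have hne : ∀ᵐ t : ℝ, t ≠ T := by simp [ae_iff]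
      filter_upwards [hpd, hne] with t htd htne ht
      rcases lt_or_gt_of_ne htne with h | h
      · rw [if_pos h.le, hq1 t h.le]
        refine (htd ⟨ht.1, h.le⟩).congr_of_eventuallyEq ?_
        filter_upwards [Iio_mem_nhds h] with s hs using hq1 s (le_of_lt hs)
      · rw [if_neg (not_le.2 h), hq2 t h.le, hD U₀ hU₀]
        refine (hed t).congr_of_eventuallyEq ?_
        filter_upwards [Ioi_mem_nhds h] with s hs using hq2 s (le_of_lt hs)

theorem flowOrbit_subset_reach {L : CMat n → CMat n} (hD : HasRates L V) {x : Fin n → ℝ}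
    (hx : x ∈ stdSimplex ℝ (Fin n)) : flowOrbit V x ⊆ reach L x := by
  rintro _ ⟨Φ, hΦ, rfl⟩
  obtain ⟨C, hC⟩ := (isCompact_generators V).isBounded.exists_norm_le
  obtain ⟨T, hT, p, hpΔ, hpL, hp0, hpT, U, hUm, hU, hpd⟩ :=
    exists_lipschitz_path_of_mem_flows hD (C := C.toNNReal)
      (fun M hM => (hC M hM).trans (Real.le_coe_toNNReal C)) hx hΦ
  refine ⟨T, hT, p, ⟨hpΔ, fun a ha b hb => ?_, U, hUm, hU, hpd⟩, hp0, hpT⟩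
  exact (hpL.mono (ordConnected_Icc.uIcc_subset ha hb)).absolutelyContinuousOnInterval

theorem IsRelaxedSolution.mem_closure_flowOrbit {L : CMat n → CMat n} (hD : HasRates L V)
    {I : Set ℝ} {x : ℝ → Fin n → ℝ} (hx : IsRelaxedSolution L I x) {T : ℝ} (hT : 0 ≤ T)
    (hI : Icc 0 T ⊆ I) : x T ∈ closure (flowOrbit V (x 0)) := by
  refine _root_.mem_closure_flowOrbit hT
    (hx.2.1 0 (hI (left_mem_Icc.2 hT)) T (hI (right_mem_Icc.2 hT))) (fun t ht => hx.1 t (hI ht)) ?_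
  filter_upwards [ae_restrict_of_ae_restrict_of_subset hI hx.2.2] with t ⟨v, hv, hd⟩
  rw [hD.convexHull_derv_eq] at hv
  obtain ⟨M, hM, rfl⟩ := hv
  exact ⟨M, hM, hd⟩

theorem IsReducedSolution.isRelaxedSolution {L : CMat n → CMat n} {I : Set ℝ}
    {x : ℝ → Fin n → ℝ} (hx : IsReducedSolution L I x) : IsRelaxedSolution L I x := by
  obtain ⟨h1, h2, U, -, hU, hd⟩ := hx
  exact ⟨h1, h2, hd.mono fun t ht => ⟨_, subset_convexHull ℝ _ ⟨U t, hU t, rfl⟩, ht⟩⟩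

/-- Piecewise constant controls are admissible, which gives one inclusion; a reduced solution is a
relaxed one, hence is approximated by them, which gives the other. -/
theorem closure_reach_eq {L : CMat n → CMat n} (hD : HasRates L V) {x : Fin n → ℝ}
    (hx : x ∈ stdSimplex ℝ (Fin n)) : closure (reach L x) = closure (flowOrbit V x) := by
  refine Subset.antisymm (closure_minimal ?_ isClosed_closure)
    (closure_mono (flowOrbit_subset_reach hD hx))
  rintro _ ⟨T, hT, p, hp, rfl, rfl⟩
  exact hp.isRelaxedSolution.mem_closure_flowOrbit hD hT Subset.rfl

theorem isApproxReachable_iff {L : CMat n → CMat n} (hD : HasRates L V) {F : Set (Fin n → ℝ)} :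
    IsApproxReachable L F ↔ ∃ x ∈ stdSimplex ℝ (Fin n), x ∉ F ∧
      ∃ y ∈ intrinsicInterior ℝ F, y ∈ closure (flowOrbit V x) := by
  refine exists_congr fun x => and_congr_right fun hx => and_congr_right fun _ => ?_
  rw [closure_reach_eq hD hx, inter_comm]
  rfl

theorem IsDirectlyReachable.isApproxReachable {L : CMat n → CMat n} (hD : HasRates L V)
    {F : Set (Fin n → ℝ)} (hF : IsDirectlyReachable L F) : IsApproxReachable L F := by
  obtain ⟨x, hx, hx0, y, hy, hlim⟩ := hF
  refine (isApproxReachable_iff hD).2 ⟨x 0, hx.1 0 self_mem_Ici, hx0, y, hy, ?_⟩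
  refine isClosed_closure.mem_of_tendsto hlim ?_
  filter_upwards [eventually_ge_atTop 0] with T hT
  exact hx.mem_closure_flowOrbit hD hT Icc_subset_Ici_self

end Reachability

/-! ### Relative interior and tangent directions of a face. -/

section Faces

variable {n : ℕ} {S : Finset (Fin n)}

/-- A relative interior point can be moved slightly away from the vertex eᵢ within the face, which
would make the i-th coordinate negative if it were zero. Conversely, positivity of the coordinates
in S is an open condition on the affine span, and there it implies membership in the face. -/
theorem mem_intrinsicInterior_simplexFace {y : Fin n → ℝ} :
    y ∈ intrinsicInterior ℝ (simplexFace S) ↔ y ∈ simplexFace S ∧ ∀ i ∈ S, 0 < y i := by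
  constructor
  · intro hy
    have hyF := intrinsicInterior_subset hy
    refine ⟨hyF, fun i hi => ?_⟩
    obtain ⟨⟨z, hz⟩, hzint, rfl⟩ := mem_intrinsicInterior.1 hy
    have hei : Pi.single i (1 : ℝ) ∈ simplexFace S :=
      ⟨single_mem_stdSimplex ℝ i, fun j hj => Pi.single_eq_of_ne (fun h : j = i => hj (h ▸ hi)) _⟩
    let g : ℝ → affineSpan ℝ (simplexFace S) := fun t =>
      ⟨AffineMap.lineMap z (Pi.single i (1 : ℝ)) t,
        AffineMap.lineMap_mem t hz (subset_affineSpan ℝ _ hei)⟩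
    have hg : Continuous g := Continuous.subtype_mk (AffineMap.lineMap_continuous) _
    have hg0 : g 0 = ⟨z, hz⟩ := Subtype.ext (AffineMap.lineMap_apply_zero _ _)
    have hev : ∀ᶠ t in 𝓝 (0 : ℝ), (g t : Fin n → ℝ) ∈ simplexFace S := by
      have := hg.continuousAt.preimage_mem_nhds (x := 0)
        (by rw [hg0]; exact mem_interior_iff_mem_nhds.1 hzint)
      exact this
    obtain ⟨ε, hε, hball⟩ := Metric.eventually_nhds_iff.1 hev
    have hmem := hball (y := -(ε / 2)) (by
      rw [Real.dist_eq, sub_zero, abs_neg, abs_of_pos (by linarith)]; linarith)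
    have hi0 := hmem.1.1 i
    have : (g (-(ε / 2)) : Fin n → ℝ) i = -(ε / 2) * (1 - z i) + z i := by
      simp [g, AffineMap.lineMap_apply]
    rw [this] at hi0
    change 0 < z i
    by_contra hneg
    nlinarith [hyF.1.1 i]
  · rintro ⟨hyF, hpos⟩
    refine mem_intrinsicInterior.2 ⟨⟨y, subset_affineSpan ℝ _ hyF⟩, ?_, rfl⟩
    have hspan : ∀ z ∈ affineSpan ℝ (simplexFace S), ∑ i, z i = 1 ∧ ∀ i ∉ S, z i = 0 := by
      intro z hz
      refine affineSpan_induction (p := fun z => ∑ i, z i = 1 ∧ ∀ i ∉ S, z i = 0) hz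
        (fun z hz => ⟨hz.1.2, hz.2⟩) fun c u v w hu hv hw => ?_
      · constructor
        · simp only [vsub_eq_sub, vadd_eq_add, Pi.add_apply, Pi.smul_apply, Pi.sub_apply,
            smul_eq_mul, Finset.sum_add_distrib, ← Finset.mul_sum, Finset.sum_sub_distrib,
            hu.1, hv.1, hw.1]
          ring
        · intro i hi
          simp [hu.2 i hi, hv.2 i hi, hw.2 i hi]
    have hopen : IsOpen {z : affineSpan ℝ (simplexFace S) | ∀ i ∈ S, 0 < (z : Fin n → ℝ) i} := by
      simp only [ofPred_forall]
      refine isOpen_biInter_finset fun i _ => ?_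
      exact isOpen_lt continuous_const ((continuous_apply i).comp continuous_subtype_val)
    refine interior_maximal ?_ hopen hpos
    rintro ⟨z, hz⟩ hzpos
    obtain ⟨h1, h2⟩ := hspan z hz
    refine ⟨⟨fun i => ?_, h1⟩, h2⟩
    by_cases hi : i ∈ S
    · exact (hzpos i hi).le
    · exact (h2 i hi).ge

theorem apply_eq_zero_of_mem_vectorSpan_simplexFace {v : Fin n → ℝ}
    (hv : v ∈ vectorSpan ℝ (simplexFace S)) {i : Fin n} (hi : i ∉ S) : v i = 0 := by
  have : vectorSpan ℝ (simplexFace S) ≤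
      LinearMap.ker (LinearMap.proj (R := ℝ) (φ := fun _ : Fin n => ℝ) i) := by
    rw [vectorSpan_def, Submodule.span_le]
    rintro _ ⟨u, hu, w, hw, rfl⟩
    simp [hu.2 i hi, hw.2 i hi]
  exact this hv

end Faces

/-! ### Barrier functions for the orbit. -/

section Barrier

/-- After the last time at which g is nonnegative, g is negative and thus nondecreasing, so it
cannot end up negative. -/
theorem nonneg_of_hasDerivAt_nonneg_of_nonpos {g g' : ℝ → ℝ}
    (hg : ∀ t, HasDerivAt g (g' t) t) (h0 : 0 ≤ g 0) (h : ∀ t, 0 ≤ t → g t ≤ 0 → 0 ≤ g' t)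
    {t : ℝ} (ht : 0 ≤ t) : 0 ≤ g t := by
  by_contra! hlt
  have hcont : Continuous g := continuous_iff_continuousAt.2 fun t => (hg t).continuousAt
  have hK : IsCompact (Icc 0 t ∩ {s | 0 ≤ g s}) :=
    isCompact_Icc.inter_right (isClosed_le continuous_const hcont)
  obtain ⟨s, ⟨⟨hs0, hst⟩, hsg⟩, hmax⟩ := hK.exists_isGreatest ⟨0, ⟨le_rfl, ht⟩, h0⟩
  have hmono : MonotoneOn g (Icc s t) := by
    refine monotoneOn_of_deriv_nonneg (convex_Icc s t) hcont.continuousOn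
      (fun u _ => (hg u).differentiableAt.differentiableWithinAt) fun u hu => ?_
    rw [interior_Icc] at hu
    rw [(hg u).deriv]
    refine h u (hs0.trans hu.1.le) ?_
    by_contra! hpos
    exact absurd (hmax ⟨⟨hs0.trans hu.1.le, hu.2.le⟩, hpos.le⟩) (not_le.2 hu.1)
  have := hmono (left_mem_Icc.2 hst) (right_mem_Icc.2 hst) hst
  linarith [show 0 ≤ g s from hsg]

variable {n r : ℕ} {V : Fin r → CMat n}

/-- The one-dimensional criterion applies along each exponential factor, and the inequality passes
to the closure. The sign of the derivative is needed only where the barrier has already been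
reached. -/
theorem barrier_nonneg {G : (Fin n → ℝ) → ℝ} {G' : (Fin n → ℝ) → (Fin n → ℝ) →L[ℝ] ℝ}
    (hG : ∀ p, HasFDerivAt G (G' p) p) {x : Fin n → ℝ} (hx : 0 ≤ G x)
    (h : ∀ p ∈ flowOrbit V x, ∀ M ∈ generators V, G p ≤ 0 → 0 ≤ G' p (M p)) :
    ∀ p ∈ closure (flowOrbit V x), 0 ≤ G p := by
  have hcont : Continuous G := continuous_iff_continuousAt.2 fun p => (hG p).continuousAt
  refine fun p hp => closure_minimal ?_ (isClosed_le continuous_const hcont) hp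
  rintro _ ⟨Φ, hΦ, rfl⟩
  change 0 ≤ G (Φ x)
  have hΦ' : Φ ∈ flows V := hΦ
  clear hΦ
  induction hΦ' using Submonoid.closure_induction_left with
  | one => exact hx
  | mul_left Ψ hΨ Φ hΦ ih =>
    obtain ⟨τ, hτ, M, hM, rfl⟩ := hΨ
    refine nonneg_of_hasDerivAt_nonneg_of_nonpos
      (g := fun s => G (NormedSpace.exp (s • M) (Φ x)))
      (fun s => (hG _).comp_hasDerivAt s (hasDerivAt_exp_smul_apply M (Φ x) s)) ?_
      (fun s hs hle => h _ ⟨NormedSpace.exp (s • M) * Φ, ?_, rfl⟩ M hM hle) hτ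
    · simpa using ih
    · exact mul_mem (exp_mem_flows hs hM) hΦ

end Barrier

/-! ### Mass balance across a face. -/

section Faces

variable {n : ℕ}

/-- The total rate of the transitions that leave the face given by `S`. -/
noncomputable def outRate (J : Fin n → Fin n → ℝ) (S : Finset (Fin n)) : ℝ :=
  ∑ i ∈ Sᶜ, ∑ j ∈ S, J i j

/-- The total rate of the transitions that enter the face given by `S`. -/
noncomputable def inRate (J : Fin n → Fin n → ℝ) (S : Finset (Fin n)) : ℝ :=
  ∑ i ∈ Sᶜ, ∑ j ∈ S, J j i

/-- The sum of the coordinates outside of `S`. -/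
noncomputable def outerMass (S : Finset (Fin n)) : (Fin n → ℝ) →L[ℝ] ℝ :=
  ∑ i ∈ Sᶜ, ContinuousLinearMap.proj (R := ℝ) (φ := fun _ : Fin n => ℝ) i

theorem outerMass_apply (S : Finset (Fin n)) (x : Fin n → ℝ) :
    outerMass S x = ∑ i ∈ Sᶜ, x i := by
  simp [outerMass, sum_apply]

theorem outerMass_nonneg (S : Finset (Fin n)) {x : Fin n → ℝ} (hx : 0 ≤ x) :
    0 ≤ outerMass S x := by
  rw [outerMass_apply]
  exact Finset.sum_nonneg fun i _ => hx i

theorem outerMass_eq_zero_iff {S : Finset (Fin n)} {x : Fin n → ℝ}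
    (hx : x ∈ stdSimplex ℝ (Fin n)) : outerMass S x = 0 ↔ x ∈ simplexFace S := by
  rw [outerMass_apply, Finset.sum_eq_zero_iff_of_nonneg fun i _ => hx.1 i]
  simp [simplexFace, hx]

theorem outerMass_pos {S : Finset (Fin n)} {x : Fin n → ℝ} (hx : x ∈ stdSimplex ℝ (Fin n))
    (hxS : x ∉ simplexFace S) : 0 < outerMass S x :=
  (outerMass_nonneg S hx.1).lt_of_ne' fun h => hxS ((outerMass_eq_zero_iff hx).1 h)

/-- Transitions between two indices outside S cancel; only those crossing between S and its
complement change the outer mass. -/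
theorem outerMass_rateField (S : Finset (Fin n)) (J : Fin n → Fin n → ℝ) (x : Fin n → ℝ) :
    outerMass S (rateField J x) =
      ∑ i ∈ Sᶜ, ∑ j ∈ S, J i j * x j - ∑ i ∈ Sᶜ, ∑ j ∈ S, J j i * x i := by
  have h : ∀ a : Fin n → ℝ, ∑ j, a j = ∑ j ∈ S, a j + ∑ j ∈ Sᶜ, a j := fun a =>
    (Finset.sum_add_sum_compl S a).symm
  simp only [outerMass_apply, rateField_apply, Finset.sum_mul]
  simp only [h, Finset.sum_sub_distrib, Finset.sum_add_distrib]
  rw [Finset.sum_comm (s := Sᶜ) (t := Sᶜ) (f := fun i j => J i j * x j)]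
  ring

theorem outRate_nonneg {J : Fin n → Fin n → ℝ} (hJ : ∀ i j, 0 ≤ J i j) (S : Finset (Fin n)) :
    0 ≤ outRate J S :=
  Finset.sum_nonneg fun _ _ => Finset.sum_nonneg fun _ _ => hJ _ _

theorem inRate_nonneg {J : Fin n → Fin n → ℝ} (hJ : ∀ i j, 0 ≤ J i j) (S : Finset (Fin n)) :
    0 ≤ inRate J S :=
  Finset.sum_nonneg fun _ _ => Finset.sum_nonneg fun _ _ => hJ _ _

theorem outRate_eq_zero_iff {J : Fin n → Fin n → ℝ} (hJ : ∀ i j, 0 ≤ J i j)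
    {S : Finset (Fin n)} : outRate J S = 0 ↔ ∀ i ∉ S, ∀ j ∈ S, J i j = 0 := by
  rw [outRate, Finset.sum_eq_zero_iff_of_nonneg fun _ _ => Finset.sum_nonneg fun _ _ => hJ _ _]
  refine forall_congr' fun i => ?_
  rw [Finset.mem_compl]
  refine imp_congr_right fun _ => ?_
  rw [Finset.sum_eq_zero_iff_of_nonneg fun _ _ => hJ _ _]

theorem outerMass_rateField_ge {J : Fin n → Fin n → ℝ} (hJ : ∀ i j, 0 ≤ J i j)
    {S : Finset (Fin n)} {x : Fin n → ℝ} (hx : 0 ≤ x) {c : ℝ} (hc : ∀ j ∈ S, c ≤ x j) :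
    c * outRate J S - outerMass S x * inRate J S ≤ outerMass S (rateField J x) := by
  rw [outerMass_rateField, outRate, inRate]
  simp only [Finset.mul_sum]
  refine sub_le_sub (Finset.sum_le_sum fun i _ => Finset.sum_le_sum fun j hj => ?_)
    (Finset.sum_le_sum fun i hi => Finset.sum_le_sum fun j _ => ?_)
  · rw [mul_comm]
    exact mul_le_mul_of_nonneg_left (hc j hj) (hJ i j)
  · rw [mul_comm]
    refine mul_le_mul_of_nonneg_right ?_ (hJ j i)
    rw [outerMass_apply]
    exact Finset.single_le_sum (fun k _ => hx k) hi

end Faces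

/-! ### What approximate reachability forces: vanishing out-rates and access to the boundary. -/

section Reachability

variable {n r : ℕ} {V : Fin r → CMat n}

theorem continuous_outRate (V : Fin r → CMat n) (S : Finset (Fin n)) :
    Continuous fun U => outRate (lindbladRate V U) S :=
  continuous_finsetSum _ fun _ _ => continuous_finsetSum _ fun _ _ => continuous_lindbladRate V _ _

theorem continuous_inRate (V : Fin r → CMat n) (S : Finset (Fin n)) :
    Continuous fun U => inRate (lindbladRate V U) S :=
  continuous_finsetSum _ fun _ _ => continuous_finsetSum _ fun _ _ => continuous_lindbladRate V _ _

theorem exists_pos_forall_le {ι : Type*} {S : Finset ι} {y : ι → ℝ} (hy : ∀ i ∈ S, 0 < y i) :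
    ∃ ρ > 0, ∀ i ∈ S, ρ ≤ y i := by
  rcases S.eq_empty_or_nonempty with rfl | hS
  · exact ⟨1, one_pos, by simp⟩
  · exact ⟨S.inf' hS y, (Finset.lt_inf'_iff hS).2 hy, fun i hi => Finset.inf'_le y hi⟩

theorem hasFDerivAt_sum_sub_sq (y p : Fin n → ℝ) :
    HasFDerivAt (fun p : Fin n → ℝ => ∑ i, (p i - y i) ^ 2)
      (∑ i, (2 * (p i - y i)) •
        ContinuousLinearMap.proj (R := ℝ) (φ := fun _ : Fin n => ℝ) i) p := by
  refine HasFDerivAt.fun_sum fun i _ => ?_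
  have := ((ContinuousLinearMap.proj (R := ℝ) (φ := fun _ : Fin n => ℝ) i).hasFDerivAt
    (x := p)).sub_const (y i) |>.pow 2
  simpa using! this

/-- The derivative of `p ↦ outerMass S p - κ * (ρ ^ 2 - ∑ i, (p i - y i) ^ 2)`. -/
noncomputable def barrierDeriv (S : Finset (Fin n)) (κ : ℝ) (y p : Fin n → ℝ) :
    (Fin n → ℝ) →L[ℝ] ℝ :=
  outerMass S - κ • -∑ i, (2 * (p i - y i)) •
    ContinuousLinearMap.proj (R := ℝ) (φ := fun _ : Fin n => ℝ) i

theorem barrierDeriv_apply (S : Finset (Fin n)) (κ : ℝ) (y p v : Fin n → ℝ) :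
    barrierDeriv S κ y p v = outerMass S v + κ * ∑ i, 2 * (p i - y i) * v i := by
  simp [barrierDeriv, sum_apply]

theorem hasFDerivAt_outerMass_sub (S : Finset (Fin n)) (κ ρ : ℝ) (y p : Fin n → ℝ) :
    HasFDerivAt (fun p : Fin n → ℝ => outerMass S p - κ * (ρ ^ 2 - ∑ i, (p i - y i) ^ 2))
      (barrierDeriv S κ y p) p :=
  (outerMass S).hasFDerivAt.sub (((hasFDerivAt_sum_sub_sq y p).const_sub (ρ ^ 2)).const_mul κ)

theorem abs_sum_two_mul_sub_mul_le {y p v : Fin n → ℝ} (hy : y ∈ stdSimplex ℝ (Fin n))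
    (hp : p ∈ stdSimplex ℝ (Fin n)) {C : ℝ} (hv : ‖v‖ ≤ C) :
    |∑ i, 2 * (p i - y i) * v i| ≤ n * (2 * C) := by
  refine (Finset.abs_sum_le_sum_abs _ _).trans ?_
  calc ∑ i, |2 * (p i - y i) * v i| ≤ ∑ _i : Fin n, 2 * C := by
        refine Finset.sum_le_sum fun i _ => ?_
        rw [abs_mul, abs_mul, abs_two]
        have h1 : |p i - y i| ≤ 1 := by
          have a1 := (norm_le_pi_norm p i).trans (norm_le_one_of_mem_stdSimplex hp)
          have a2 := (norm_le_pi_norm y i).trans (norm_le_one_of_mem_stdSimplex hy)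
          have a3 := hp.1 i
          have a4 := hy.1 i
          rw [Real.norm_of_nonneg a3] at a1
          rw [Real.norm_of_nonneg a4] at a2
          rw [abs_le]
          constructor <;> linarith
        have h2 : |v i| ≤ C := (norm_le_pi_norm v i).trans hv
        have h3 := abs_nonneg (v i)
        nlinarith
    _ = _ := by simp

/-- Otherwise out(U) ≥ δ > 0 by compactness. Near y the coordinates in S stay above ρ, so mass leaks
out at rate at least ρδ, while the return flow is proportional to the small outer mass. Hence no
orbit crosses below the cap κ (ρ² - |p - y|²), with |·| Euclidean, whereas the outer mass of y is
zero and lies below it. -/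
theorem exists_outRate_eq_zero {S : Finset (Fin n)} {x y : Fin n → ℝ}
    (hx : x ∈ stdSimplex ℝ (Fin n)) (hxS : x ∉ simplexFace S)
    (hy : y ∈ closure (flowOrbit V x)) (hyS : y ∈ simplexFace S) (hypos : ∀ i ∈ S, 0 < y i) :
    ∃ U ∈ SUn n, outRate (lindbladRate V U) S = 0 := by
  by_contra! hne
  have hone : (1 : CMat n) ∈ SUn n := one_mem _
  obtain ⟨δ, hδ0, hδ⟩ : ∃ δ > 0, ∀ U ∈ SUn n, δ ≤ outRate (lindbladRate V U) S := by
    obtain ⟨U₁, hU₁, hmin⟩ :=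
      (isCompact_SUn n).exists_isMinOn ⟨1, hone⟩ (continuous_outRate V S).continuousOn
    exact ⟨_, (outRate_nonneg (lindbladRate_nonneg V U₁) S).lt_of_ne' (hne U₁ hU₁),
      fun U hU => hmin hU⟩
  obtain ⟨B, hB0, hB⟩ : ∃ B, 0 ≤ B ∧ ∀ U ∈ SUn n, inRate (lindbladRate V U) S ≤ B := by
    obtain ⟨U₂, hU₂, hmax⟩ :=
      (isCompact_SUn n).exists_isMaxOn ⟨1, hone⟩ (continuous_inRate V S).continuousOn
    exact ⟨_, inRate_nonneg (lindbladRate_nonneg V U₂) S, fun U hU => hmax hU⟩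
  obtain ⟨C, hC⟩ := (isCompact_generators V).isBounded.exists_norm_le
  have hC0 : 0 ≤ C := (norm_nonneg _).trans (hC _ ⟨1, hone, rfl⟩)
  obtain ⟨ρ, hρ, hρy⟩ : ∃ ρ > 0, ∀ j ∈ S, 2 * ρ ≤ y j := by
    obtain ⟨ρ, hρ, h⟩ := exists_pos_forall_le hypos
    exact ⟨ρ / 2, by linarith, fun j hj => by linarith [h j hj]⟩
  have hf0 := outerMass_pos hx hxS
  -- With κ factored out, Bρ² bounds the return flow and 2nC the derivative of the quadratic term;
  -- the summand 1 makes D positive. The first entry of the minimum defining κ puts x above the cap,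
  -- the second makes the leak dominate.
  set D : ℝ := B * ρ ^ 2 + n * (2 * C) + 1 with hD
  have hD0 : 0 < D := by positivity
  set κ : ℝ := min (outerMass S x / ρ ^ 2) (ρ * δ / D) with hκ
  have hκ0 : 0 < κ := lt_min (by positivity) (by positivity)
  have hκ1 : κ * ρ ^ 2 ≤ outerMass S x := (le_div_iff₀ (by positivity)).1 (min_le_left _ _)
  have hκ2 : κ * D ≤ ρ * δ := (le_div_iff₀ hD0).1 (min_le_right _ _)
  have hGd := fun p => hasFDerivAt_outerMass_sub S κ ρ y p
  have hyΔ := hyS.1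
  have hbar := barrier_nonneg (V := V) hGd (x := x) ?_ ?_ y hy
  · have hy0 := (outerMass_eq_zero_iff hyΔ).2 hyS
    simp only [hy0, sub_self] at hbar
    have : 0 < κ * ρ ^ 2 := by positivity
    norm_num at hbar
    linarith
  · have : 0 ≤ κ * ∑ i, (x i - y i) ^ 2 :=
      mul_nonneg hκ0.le (Finset.sum_nonneg fun i _ => sq_nonneg _)
    simp only [mul_sub]
    linarith
  · rintro p hp M hM hGp
    have hpΔ := closure_flowOrbit_subset_stdSimplex hx (subset_closure hp)
    have hfp := outerMass_nonneg S hpΔ.1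
    have hle : ∑ i, (p i - y i) ^ 2 ≤ ρ ^ 2 := by
      nlinarith
    have hfle : outerMass S p ≤ κ * ρ ^ 2 := by
      have : 0 ≤ κ * ∑ i, (p i - y i) ^ 2 :=
        mul_nonneg hκ0.le (Finset.sum_nonneg fun i _ => sq_nonneg _)
      simp only [mul_sub] at hGp
      linarith
    have hpj : ∀ j ∈ S, ρ ≤ p j := fun j hj => by
      have h1 : (p j - y j) ^ 2 ≤ ρ ^ 2 := (Finset.single_le_sum
        (f := fun i => (p i - y i) ^ 2) (fun i _ => sq_nonneg _) (Finset.mem_univ j)).trans hle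
      have h2 := abs_le.1 (abs_le_of_sq_le_sq h1 hρ.le)
      linarith [hρy j hj, h2.1]
    have hMp : ‖M p‖ ≤ C := by
      calc ‖M p‖ ≤ ‖M‖ * ‖p‖ := M.le_opNorm p
        _ ≤ C * 1 := by
          gcongr
          · exact hC M hM
          · exact norm_le_one_of_mem_stdSimplex hpΔ
        _ = C := mul_one C
    have hquad := abs_sum_two_mul_sub_mul_le hyΔ hpΔ hMp
    obtain ⟨U, hU, rfl⟩ := hM
    have hout : δ ≤ outRate (lindbladRate V U) S := hδ U hU
    have hin : inRate (lindbladRate V U) S ≤ B := hB U hU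
    have hge := outerMass_rateField_ge (lindbladRate_nonneg V U) hpΔ.1 hpj
    have h1 : ρ * δ ≤ ρ * outRate (lindbladRate V U) S := by gcongr
    have h2 : outerMass S p * inRate (lindbladRate V U) S ≤ κ * ρ ^ 2 * B :=
      mul_le_mul hfle hin (inRate_nonneg (lindbladRate_nonneg V U) S) (by positivity)
    have h3 := abs_le.1 hquad
    have h4 : κ * -(n * (2 * C)) ≤
        κ * ∑ i, 2 * (p i - y i) * rateField (lindbladRate V U) p i := by gcongr; exact h3.1
    rw [barrierDeriv_apply]
    rw [hD] at hκ2
    nlinarith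

/-- Let f be the outer mass. Where all coordinates in S are at least K f, its derivative is at least
f (K · out - in) ≥ 0. If the closed orbit avoided the relative boundary of the face, compactness
would give this lower bound whenever f is small, so f could not tend to zero. -/
theorem exists_mem_closure_flowOrbit_apply_eq_zero {S : Finset (Fin n)} {K : ℝ}
    (hK : ∀ U ∈ SUn n, inRate (lindbladRate V U) S ≤ K * outRate (lindbladRate V U) S)
    {x y : Fin n → ℝ} (hx : x ∈ stdSimplex ℝ (Fin n)) (hxS : x ∉ simplexFace S)
    (hy : y ∈ closure (flowOrbit V x)) (hyS : y ∈ simplexFace S) :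
    ∃ z ∈ closure (flowOrbit V x), z ∈ simplexFace S ∧ ∃ j ∈ S, z j = 0 := by
  by_contra! hne
  have hsub := closure_flowOrbit_subset_stdSimplex (V := V) hx
  have hcl : IsClosed {p : Fin n → ℝ | ∃ j ∈ S, p j ≤ K * outerMass S p} := by
    have : {p : Fin n → ℝ | ∃ j ∈ S, p j ≤ K * outerMass S p} =
        ⋃ j ∈ S, {p : Fin n → ℝ | p j ≤ K * outerMass S p} := by ext; simp
    rw [this]
    exact S.finite_toSet.isClosed_biUnion fun j _ =>
      isClosed_le (continuous_apply j) (continuous_const.mul (outerMass S).continuous)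
  have hcomp : IsCompact (closure (flowOrbit V x) ∩
      {p : Fin n → ℝ | ∃ j ∈ S, p j ≤ K * outerMass S p}) :=
    ((isCompact_stdSimplex ℝ (Fin n)).of_isClosed_subset isClosed_closure hsub).inter_right hcl
  obtain ⟨m, hm0, hm⟩ : ∃ m > 0, ∀ p ∈ closure (flowOrbit V x), outerMass S p < m →
      ∀ j ∈ S, K * outerMass S p ≤ p j := by
    rcases (closure (flowOrbit V x) ∩
      {p : Fin n → ℝ | ∃ j ∈ S, p j ≤ K * outerMass S p}).eq_empty_or_nonempty with he | hne'
    · refine ⟨1, one_pos, fun p hp _ j hj => ?_⟩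
      by_contra! hlt
      exact (Set.eq_empty_iff_forall_notMem.1 he p) ⟨hp, j, hj, hlt.le⟩
    -- The threshold is the least outer mass at a point where the bound fails or is attained; were
    -- it zero, q would be a boundary point of the face.
    · obtain ⟨q, ⟨hq, j, hj, hqj⟩, hmin⟩ :=
        hcomp.exists_isMinOn hne' (outerMass S).continuous.continuousOn
      refine ⟨outerMass S q, ?_, fun p hp hlt j hj => ?_⟩
      · refine (outerMass_nonneg S (hsub hq).1).lt_of_ne' fun h0 => ?_
        rw [h0, mul_zero] at hqj
        exact hne q hq ((outerMass_eq_zero_iff (hsub hq)).1 h0) j hj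
          (le_antisymm hqj ((hsub hq).1 j))
      · by_contra! hlt'
        exact absurd (hmin ⟨hp, j, hj, hlt'.le⟩) (not_le.2 hlt)
  have hf0 := outerMass_pos hx hxS
  set ε := min (outerMass S x) (m / 2) with hε
  have hε0 : 0 < ε := lt_min hf0 (by linarith)
  have hbar := barrier_nonneg (V := V) (G := fun p => outerMass S p - ε)
    (fun p => (outerMass S).hasFDerivAt.sub_const ε) (x := x) (sub_nonneg.2 (min_le_left _ _)) ?_
    y hy
  · rw [(outerMass_eq_zero_iff hyS.1).2 hyS] at hbar
    linarith
  · rintro p hp M ⟨U, hU, rfl⟩ hle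
    have hpΔ := hsub (subset_closure hp)
    have hlt : outerMass S p < m := by
      have := min_le_right (outerMass S x) (m / 2)
      linarith
    have hge := outerMass_rateField_ge (lindbladRate_nonneg V U) hpΔ.1
      (hm p (subset_closure hp) hlt)
    have h1 := mul_le_mul_of_nonneg_left (hK U hU) (outerMass_nonneg S hpΔ.1)
    refine le_trans ?_ hge
    linarith

theorem exists_lowerFace_isApproxReachable {L : CMat n → CMat n} (hD : HasRates L V)
    {S : Finset (Fin n)} {K : ℝ}
    (hK : ∀ U ∈ SUn n, inRate (lindbladRate V U) S ≤ K * outRate (lindbladRate V U) S)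
    (hS : IsApproxReachable L (simplexFace S)) : LowerFaceApproxReachable L S := by
  obtain ⟨x, hx, hxS, y, hy, hycl⟩ := (isApproxReachable_iff hD).1 hS
  obtain ⟨z, hz, hzS, j, hj, hzj⟩ := exists_mem_closure_flowOrbit_apply_eq_zero hK hx hxS hycl
    (mem_intrinsicInterior_simplexFace.1 hy).1
  classical
  -- The support of z picks the face having z in its relative interior.
  set T : Finset (Fin n) := {i | z i ≠ 0} with hT
  have hTS : T ⊂ S := by
    refine (Finset.ssubset_iff_of_subset fun i hi => ?_).2 ⟨j, hj, by simp [hT, hzj]⟩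
    by_contra h
    exact (Finset.mem_filter.1 hi).2 (hzS.2 i h)
  refine ⟨T, ?_, Finset.card_lt_card hTS, (isApproxReachable_iff hD).2 ⟨x, hx, fun h => hxS ?_, z,
    mem_intrinsicInterior_simplexFace.2 ⟨⟨hzS.1, fun i hi => ?_⟩, fun i hi => ?_⟩, hz⟩⟩
  · by_contra hemp
    rw [Finset.not_nonempty_iff_eq_empty] at hemp
    have h0 : ∀ i, z i = 0 := fun i => by
      by_contra h
      exact Finset.notMem_empty i (hemp ▸ Finset.mem_filter.2 ⟨Finset.mem_univ i, h⟩)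
    have := hzS.1.2
    simp [h0] at this
  · exact ⟨h.1, fun i hi => h.2 i fun hiT => hi (hTS.1 hiT)⟩
  · by_contra h
    exact hi (by simp [hT, h])
  · exact (hzS.1.1 i).lt_of_ne' (Finset.mem_filter.1 hi).2

end Reachability

/-! ### Invariant subspaces as graphs over a coordinate subspace. -/

section Blocks

variable {A : Type*} [Ring A] {e z y w : A}

/-- With e a projection and w block diagonal, e + z parametrizes the graph of z. The expression
measures how far w is from preserving that graph; it is linear in z because the quadratic term z w z
vanishes. -/
theorem lower_block_eq_commutator (he : e * e = e) (hez : e * z = 0) (hze : z * e = z)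
    (hw : w * e = e * w) : (1 - e - z) * w * (e + z) = w * z - z * w := by
  have h1 : e * w * z = 0 := by rw [← hw, mul_assoc, hez, mul_zero]
  have h2 : e * w * e = w * e := by rw [← hw, mul_assoc, he]
  have h3 : z * w * e = z * w := by rw [mul_assoc, hw, ← mul_assoc, hze]
  have h4 : z * w * z = 0 := by rw [← h3, mul_assoc, hez, mul_zero]
  calc (1 - e - z) * w * (e + z) =
      w * e - e * w * e - z * w * e + (w * z - e * w * z - z * w * z) := by noncomm_ring
    _ = _ := by rw [h1, h2, h3, h4]; noncomm_ring

theorem upper_block_eq_commutator (he : e * e = e) (hey : e * y = y) (hye : y * e = 0)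
    (hw : w * e = e * w) : (e + y) * w * (1 - e - y) = y * w - w * y := by
  have h1 : e * w * y = w * y := by rw [← hw, mul_assoc, hey]
  have h2 : e * w * e = e * w := by rw [mul_assoc, hw, ← mul_assoc, he]
  have h3 : y * w * e = 0 := by rw [mul_assoc, hw, ← mul_assoc, hye, zero_mul]
  have h4 : y * w * y = 0 := by
    calc y * w * y = y * w * e * y := by rw [mul_assoc (y * w), hey]
      _ = 0 := by rw [h3, zero_mul]
  calc (e + y) * w * (1 - e - y) =
      e * w - e * w * e - e * w * y + (y * w - y * w * e - y * w * y) := by noncomm_ring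
    _ = _ := by rw [h1, h2, h3, h4]; noncomm_ring

end Blocks

section FaceProj

variable {n : ℕ}

/-- The orthogonal projection onto the span of the basis vectors in `S`. -/
noncomputable def faceProj (S : Finset (Fin n)) : CMat n :=
  Matrix.diagonal fun i => if i ∈ S then 1 else 0

theorem faceProj_mul_self (S : Finset (Fin n)) : faceProj S * faceProj S = faceProj S := by
  rw [faceProj, Matrix.diagonal_mul_diagonal]
  congr 1
  funext i
  split_ifs <;> simp

theorem conjTranspose_faceProj (S : Finset (Fin n)) : (faceProj S)ᴴ = faceProj S := by
  rw [faceProj, Matrix.diagonal_conjTranspose]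
  congr 1
  funext i
  simp only [Pi.star_apply]
  split_ifs <;> simp

theorem one_sub_faceProj (S : Finset (Fin n)) : 1 - faceProj S = faceProj Sᶜ := by
  rw [faceProj, faceProj, ← Matrix.diagonal_one, Matrix.diagonal_sub]
  congr 1
  funext i
  by_cases h : i ∈ S <;> simp [h]

theorem faceProj_mul_mul_apply (S T : Finset (Fin n)) (W : CMat n) (i j : Fin n) :
    (faceProj S * W * faceProj T) i j = if i ∈ S ∧ j ∈ T then W i j else 0 := by
  rw [faceProj, faceProj, Matrix.mul_diagonal, Matrix.diagonal_mul]
  by_cases hi : i ∈ S <;> by_cases hj : j ∈ T <;> simp [hi, hj]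

theorem sum_normSq_faceProj_mul_mul (S T : Finset (Fin n)) (W : CMat n) :
    ∑ i, ∑ j, Complex.normSq ((faceProj S * W * faceProj T) i j) =
      ∑ i ∈ S, ∑ j ∈ T, Complex.normSq (W i j) := by
  classical
  rw [← Finset.sum_subset (Finset.subset_univ S)]
  · refine Finset.sum_congr rfl fun i hi => ?_
    rw [← Finset.sum_subset (Finset.subset_univ T)]
    · exact Finset.sum_congr rfl fun j hj => by
        rw [faceProj_mul_mul_apply, if_pos ⟨hi, hj⟩]
    · intro j _ hj
      rw [faceProj_mul_mul_apply, if_neg fun h => hj h.2, map_zero]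
  · intro i _ hi
    exact Finset.sum_eq_zero fun j _ => by
      rw [faceProj_mul_mul_apply, if_neg fun h => hi h.1, map_zero]

end FaceProj

section Unitary

variable {n : ℕ}

open scoped Matrix.Norms.L2Operator MatrixOrder ComplexOrder in
/-- A positive definite matrix has a positive invertible square root in its bicommutant. -/
theorem Matrix.PosDef.exists_isHermitian_sq_eq {H : CMat n} (hH : H.PosDef) :
    ∃ Q : CMat n, Q.IsHermitian ∧ Q * Q = H ∧ IsUnit Q ∧ ∀ B, Commute H B → Commute Q B := by
  have h0 : 0 ≤ H := hH.posSemidef.nonneg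
  have hsq : CFC.sqrt H * CFC.sqrt H = H := CFC.sqrt_mul_sqrt_self H
  refine ⟨CFC.sqrt H, ?_, hsq, ?_, fun B hB => ?_⟩
  · exact (CFC.sqrt_nonneg H).isSelfAdjoint
  · have : IsUnit (CFC.sqrt H * CFC.sqrt H) := by rw [hsq]; exact hH.isUnit
    exact isUnit_of_mul_isUnit_left this
  · exact hB.cfcₙ_nnreal _

open scoped ComplexOrder in
/-- The graph of `Z` is spanned by the columns in `S` of a unitary matrix. -/
theorem exists_unitary_block_eq {S : Finset (Fin n)} {Z : CMat n} (hEZ : faceProj S * Z = 0)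
    (hZE : Z * faceProj S = Z) :
    ∃ R Q : CMat n, Rᴴ * R = 1 ∧ IsUnit Q ∧ Commute Q (faceProj S) ∧
      R * faceProj S = (faceProj S + Z) * Q ∧
      R * (1 - faceProj S) = (1 - faceProj S - Zᴴ) * Q := by
  set E := faceProj S with hE
  have hEE : E * E = E := faceProj_mul_self S
  have hEZ' : E * Zᴴ = Zᴴ := by
    conv_rhs => rw [← hZE, Matrix.conjTranspose_mul, conjTranspose_faceProj]
  have hZE' : Zᴴ * E = 0 := by
    have := congrArg Matrix.conjTranspose hEZ
    rwa [Matrix.conjTranspose_mul, conjTranspose_faceProj, Matrix.conjTranspose_zero] at this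
  have hZZ : Z * Z = 0 := by
    calc Z * Z = Z * E * Z := by rw [hZE]
      _ = 0 := by rw [mul_assoc, hEZ, mul_zero]
  have hZZ' : Zᴴ * Zᴴ = 0 := by rw [← Matrix.conjTranspose_mul, hZZ, Matrix.conjTranspose_zero]
  -- The two column blocks of G span the graph of Z and its orthogonal complement. Since G* G is
  -- block diagonal, so is (G* G)^(-1/2), and normalizing with it preserves both spans.
  set G : CMat n := 1 + Z - Zᴴ with hG
  have hGG : Gᴴ * G = 1 + (Z * Zᴴ + Zᴴ * Z) := by
    rw [hG, Matrix.conjTranspose_sub, Matrix.conjTranspose_add, Matrix.conjTranspose_one,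
      Matrix.conjTranspose_conjTranspose]
    calc (1 + Zᴴ - Z) * (1 + Z - Zᴴ) = 1 + (Z * Zᴴ + Zᴴ * Z) - Z * Z - Zᴴ * Zᴴ := by noncomm_ring
      _ = _ := by rw [hZZ, hZZ', sub_zero, sub_zero]
  have hpos : (Gᴴ * G).PosDef := by
    rw [hGG]
    exact Matrix.PosDef.one.add_posSemidef ((Matrix.posSemidef_self_mul_conjTranspose Z).add
      (Matrix.posSemidef_conjTranspose_mul_self Z))
  have hcomm : Commute (Gᴴ * G) E := by
    rw [hGG]
    change _ * _ = _ * _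
    have h1 : Zᴴ * Z * E = Zᴴ * Z := by rw [mul_assoc, hZE]
    have h2 : E * (Zᴴ * Z) = Zᴴ * Z := by rw [← mul_assoc, hEZ']
    have h3 : Z * Zᴴ * E = 0 := by rw [mul_assoc, hZE', mul_zero]
    have h4 : E * (Z * Zᴴ) = 0 := by rw [← mul_assoc, hEZ, zero_mul]
    rw [add_mul, add_mul, mul_add, mul_add, h1, h2, h3, h4, one_mul, mul_one]
  obtain ⟨Q, hQ, hQQ, hQu, hQc⟩ := hpos.exists_isHermitian_sq_eq
  have hdet : IsUnit Q.det := (Matrix.isUnit_iff_isUnit_det Q).1 hQu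
  have hQi : Commute Q⁻¹ E := by
    have h := hQc E hcomm
    change Q⁻¹ * E = E * Q⁻¹
    calc Q⁻¹ * E = Q⁻¹ * (E * Q) * Q⁻¹ := by
          rw [mul_assoc, mul_assoc, Matrix.mul_nonsing_inv Q hdet, mul_one]
      _ = E * Q⁻¹ := by
          rw [← h.eq, ← mul_assoc, Matrix.nonsing_inv_mul Q hdet, one_mul]
  have hGE : G * E = E + Z := by
    rw [hG, sub_mul, add_mul, one_mul, hZE, hZE', sub_zero]
  refine ⟨G * Q⁻¹, Q⁻¹, ?_, ?_, hQi, ?_, ?_⟩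
  · rw [Matrix.conjTranspose_mul, Matrix.conjTranspose_nonsing_inv, hQ.eq]
    calc Q⁻¹ * Gᴴ * (G * Q⁻¹) = Q⁻¹ * (Gᴴ * G) * Q⁻¹ := by simp only [mul_assoc]
      _ = 1 := by
        rw [← hQQ, ← mul_assoc, Matrix.nonsing_inv_mul Q hdet, one_mul,
          Matrix.mul_nonsing_inv Q hdet]
  · exact (Matrix.isUnit_iff_isUnit_det _).2 (Matrix.isUnit_nonsing_inv_det Q hdet)
  · rw [mul_assoc, hQi.eq, ← mul_assoc, hGE]
  · rw [mul_assoc, mul_sub, mul_one, hQi.eq]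
    have : Q⁻¹ - E * Q⁻¹ = (1 - E) * Q⁻¹ := by rw [sub_mul, one_mul]
    rw [this, ← mul_assoc, mul_sub, mul_one, hGE, hG]
    congr 1
    abel

/-- A unitary matrix whose diagonal blocks are invertible is a graph up to these blocks. -/
theorem exists_graph_of_unitary {S : Finset (Fin n)} {R D : CMat n} (hR : Rᴴ * R = 1)
    (hD : D = faceProj S * R * faceProj S + (1 - faceProj S) * R * (1 - faceProj S))
    (hDu : IsUnit D) :
    ∃ Z : CMat n, faceProj S * Z = 0 ∧ Z * faceProj S = Z ∧
      R * faceProj S = (faceProj S + Z) * D ∧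
      R * (1 - faceProj S) = (1 - faceProj S - Zᴴ) * D := by
  set E := faceProj S with hE
  have hEE : E * E = E := faceProj_mul_self S
  have hEH : Eᴴ = E := conjTranspose_faceProj S
  have hFE : (1 - E) * E = 0 := by rw [sub_mul, one_mul, hEE, sub_self]
  have hEF : E * (1 - E) = 0 := by rw [mul_sub, mul_one, hEE, sub_self]
  have hFF : (1 - E) * (1 - E) = 1 - E := by rw [mul_sub, hFE, mul_one, sub_zero]
  have hFH : (1 - E)ᴴ = 1 - E := by rw [Matrix.conjTranspose_sub, Matrix.conjTranspose_one, hEH]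
  have hED : E * D = E * R * E := by
    rw [hD, mul_add]
    simp only [← mul_assoc]
    rw [hEE, hEF, zero_mul, zero_mul, add_zero]
  have hDE : D * E = E * R * E := by
    rw [hD, add_mul]
    simp only [mul_assoc]
    rw [hEE, hFE, mul_zero, mul_zero, add_zero]
  have hFD : (1 - E) * D = (1 - E) * R * (1 - E) := by
    rw [hD, mul_add]
    simp only [← mul_assoc]
    rw [hFF, hFE, zero_mul, zero_mul, zero_add]
  have hdet : IsUnit D.det := (Matrix.isUnit_iff_isUnit_det D).1 hDu
  have hDD : D * D⁻¹ = 1 := Matrix.mul_nonsing_inv D hdet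
  have hDD' : D⁻¹ * D = 1 := Matrix.nonsing_inv_mul D hdet
  have hDiE : D⁻¹ * E = E * D⁻¹ := by
    calc D⁻¹ * E = D⁻¹ * (E * D) * D⁻¹ := by rw [mul_assoc, mul_assoc, hDD, mul_one]
      _ = E * D⁻¹ := by rw [hED, ← hDE, ← mul_assoc, hDD', one_mul]
  -- Dividing by the diagonal blocks turns them into identities, so that only the off-diagonal
  -- blocks Z and Y remain.
  set G := R * D⁻¹ with hG
  have hGD : G * D = R := by rw [hG, mul_assoc, hDD', mul_one]
  set Z := (1 - E) * G * E with hZ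
  set Y := E * G * (1 - E) with hY
  have hEGE : E * G * E = E := by
    rw [hG, mul_assoc, mul_assoc, hDiE, ← mul_assoc, ← mul_assoc, ← hED, mul_assoc, hDD,
      mul_one]
  have hDiF : D⁻¹ * (1 - E) = (1 - E) * D⁻¹ := by rw [mul_sub, sub_mul, hDiE, mul_one, one_mul]
  have hFGF : (1 - E) * G * (1 - E) = 1 - E := by
    rw [hG, mul_assoc, mul_assoc, hDiF, ← mul_assoc, ← mul_assoc, ← hFD, mul_assoc, hDD,
      mul_one]
  have hGE : G * E = E + Z := by
    calc G * E = E * G * E + (1 - E) * G * E := by noncomm_ring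
      _ = _ := by rw [hEGE]
  have hGF : G * (1 - E) = 1 - E + Y := by
    calc G * (1 - E) = (1 - E) * G * (1 - E) + E * G * (1 - E) := by noncomm_ring
      _ = _ := by rw [hFGF]
  have hEZ : E * Z = 0 := by rw [hZ, ← mul_assoc, ← mul_assoc, hEF, zero_mul, zero_mul]
  have hZE : Z * E = Z := by rw [hZ, mul_assoc, hEE]
  have hEY : E * Y = Y := by rw [hY, ← mul_assoc, ← mul_assoc, hEE]
  have hZE' : Zᴴ * E = 0 := by
    have := congrArg Matrix.conjTranspose hEZ
    rwa [Matrix.conjTranspose_mul, hEH, Matrix.conjTranspose_zero] at this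
  -- The two column blocks of R are orthogonal, and the block diagonal D preserves this; written
  -- out, it forces Y = -Z*.
  have hzero : (G * E)ᴴ * (G * (1 - E)) = 0 := by
    have h1 : Gᴴ * G = (D⁻¹)ᴴ * D⁻¹ := by
      rw [hG, Matrix.conjTranspose_mul]
      calc (D⁻¹)ᴴ * Rᴴ * (R * D⁻¹) = (D⁻¹)ᴴ * (Rᴴ * R) * D⁻¹ := by simp only [mul_assoc]
        _ = _ := by rw [hR, mul_one]
    have h2 : E * (D⁻¹)ᴴ = (D⁻¹)ᴴ * E := by
      have := congrArg Matrix.conjTranspose hDiE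
      rwa [Matrix.conjTranspose_mul, Matrix.conjTranspose_mul, hEH] at this
    rw [Matrix.conjTranspose_mul, hEH]
    calc E * Gᴴ * (G * (1 - E)) = E * (Gᴴ * G) * (1 - E) := by simp only [mul_assoc]
      _ = (E * (D⁻¹)ᴴ) * (D⁻¹ * (1 - E)) := by rw [h1]; simp only [mul_assoc]
      _ = (D⁻¹)ᴴ * (E * (1 - E)) * D⁻¹ := by rw [h2, hDiF]; simp only [mul_assoc]
      _ = 0 := by rw [hEF, mul_zero, zero_mul]
  have hYZ : Y = -Zᴴ := by
    have hZY : Zᴴ * Y = 0 := by rw [← hEY, ← mul_assoc, hZE', zero_mul]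
    rw [hGE, hGF, Matrix.conjTranspose_add, hEH, add_mul, mul_add, mul_add, hEF, hEY, hZY,
      mul_sub, mul_one, hZE', sub_zero, add_zero, zero_add] at hzero
    exact eq_neg_of_add_eq_zero_left hzero
  refine ⟨Z, hEZ, hZE, ?_, ?_⟩
  · rw [← hGE, mul_assoc, hED, ← hDE, ← mul_assoc, hGD]
  · have hDF : D * (1 - E) = (1 - E) * D := by rw [mul_sub, sub_mul, hED, hDE, mul_one, one_mul]
    rw [sub_eq_add_neg (1 - E), ← hYZ, ← hGF, mul_assoc, ← hDF, ← mul_assoc, hGD]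

end Unitary

/-- The inclusion of kernels lets β factor through α, and the factor, extended to a
finite-dimensional space, is bounded. -/
theorem LinearMap.exists_norm_le_of_ker_le {𝕜 E F G : Type*} [NontriviallyNormedField 𝕜]
    [CompleteSpace 𝕜] [AddCommGroup E] [Module 𝕜 E] [NormedAddCommGroup F] [NormedSpace 𝕜 F]
    [FiniteDimensional 𝕜 F] [NormedAddCommGroup G] [NormedSpace 𝕜 G]
    (α : E →ₗ[𝕜] F) (β : E →ₗ[𝕜] G) (h : LinearMap.ker α ≤ LinearMap.ker β) :
    ∃ C : ℝ, 0 ≤ C ∧ ∀ x, ‖β x‖ ≤ C * ‖α x‖ := by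
  obtain ⟨γ, hγ⟩ := LinearMap.exists_extend
    ((LinearMap.ker α).liftQ β h ∘ₗ α.quotKerEquivRange.symm.toLinearMap)
  have hγα : ∀ x, γ (α x) = β x := fun x => by
    have := LinearMap.congr_fun hγ ⟨α x, LinearMap.mem_range_self α x⟩
    rw [LinearMap.comp_apply, Submodule.subtype_apply] at this
    rw [this, LinearMap.comp_apply, LinearEquiv.coe_coe,
      LinearMap.quotKerEquivRange_symm_apply_image, Submodule.mkQ_apply, Submodule.liftQ_apply]
  refine ⟨‖LinearMap.toContinuousLinearMap γ‖, norm_nonneg _, fun x => ?_⟩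
  rw [← hγα]
  exact (LinearMap.toContinuousLinearMap γ).le_opNorm (α x)

/-! ### Comparison of the two off-diagonal blocks. -/

section Commutators

variable {n r : ℕ}

/-- The commutators of the matrices `Wₖ` with the block of a matrix off the diagonal. -/
noncomputable def blockCommutator (S : Finset (Fin n)) (W : Fin r → CMat n) :
    CMat n →ₗ[ℂ] (Fin r → CMat n) :=
  LinearMap.pi fun k => (LinearMap.mulLeft ℂ (W k) - LinearMap.mulRight ℂ (W k)) ∘ₗ
    (LinearMap.mulLeft ℂ (1 - faceProj S) ∘ₗ LinearMap.mulRight ℂ (faceProj S))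

theorem blockCommutator_apply (S : Finset (Fin n)) (W : Fin r → CMat n) (X : CMat n) (k : Fin r) :
    blockCommutator S W X k = W k * ((1 - faceProj S) * (X * faceProj S)) -
      (1 - faceProj S) * (X * faceProj S) * W k := rfl

open scoped Matrix.Norms.Frobenius

theorem frobenius_norm_sq_eq (A : CMat n) : ‖A‖ ^ 2 = ∑ i, ∑ j, Complex.normSq (A i j) := by
  rw [Matrix.frobenius_norm_def, ← Real.sqrt_eq_rpow, Real.sq_sqrt (by positivity)]
  simp [Complex.normSq_eq_norm_sq]

theorem outRate_lindbladRate_eq (V : Fin r → CMat n) (S : Finset (Fin n)) (U : CMat n) :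
    outRate (lindbladRate V U) S =
      ∑ k, ‖(1 - faceProj S) * (Uᴴ * V k * U) * faceProj S‖ ^ 2 := by
  simp only [frobenius_norm_sq_eq, one_sub_faceProj, sum_normSq_faceProj_mul_mul]
  unfold outRate lindbladRate
  rw [Finset.sum_comm]
  exact (Finset.sum_congr rfl fun j _ => Finset.sum_comm).trans
    (Finset.sum_comm.trans (Finset.sum_congr rfl fun k _ => Finset.sum_comm))

theorem inRate_lindbladRate_eq (V : Fin r → CMat n) (S : Finset (Fin n)) (U : CMat n) :
    inRate (lindbladRate V U) S =
      ∑ k, ‖faceProj S * (Uᴴ * V k * U) * (1 - faceProj S)‖ ^ 2 := by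
  simp only [frobenius_norm_sq_eq, one_sub_faceProj, sum_normSq_faceProj_mul_mul]
  unfold inRate lindbladRate
  rw [Finset.sum_comm]
  exact (Finset.sum_congr rfl fun j _ => Finset.sum_comm).trans Finset.sum_comm

/-- Equivalently, the span of the columns of U indexed by S is invariant under every Vₖ. The
vanishing of the in-rate expresses invariance of its orthogonal complement. -/
theorem outRate_lindbladRate_eq_zero_iff {V : Fin r → CMat n} {S : Finset (Fin n)} {U : CMat n} :
    outRate (lindbladRate V U) S = 0 ↔
      ∀ k, (1 - faceProj S) * (Uᴴ * V k * U) * faceProj S = 0 := by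
  rw [outRate_lindbladRate_eq, Finset.sum_eq_zero_iff_of_nonneg fun _ _ => by positivity]
  simp

theorem inRate_lindbladRate_eq_zero_iff {V : Fin r → CMat n} {S : Finset (Fin n)} {U : CMat n} :
    inRate (lindbladRate V U) S = 0 ↔
      ∀ k, faceProj S * (Uᴴ * V k * U) * (1 - faceProj S) = 0 := by
  rw [inRate_lindbladRate_eq, Finset.sum_eq_zero_iff_of_nonneg fun _ _ => by positivity]
  simp

theorem blocks_of_graph {S : Finset (Fin n)} {R Q Z W : CMat n} (hEZ : faceProj S * Z = 0)
    (hZE : Z * faceProj S = Z) (hW : W * faceProj S = faceProj S * W)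
    (h1 : R * faceProj S = (faceProj S + Z) * Q)
    (h2 : R * (1 - faceProj S) = (1 - faceProj S - Zᴴ) * Q) :
    (1 - faceProj S) * (Rᴴ * W * R) * faceProj S = Qᴴ * (W * Z - Z * W) * Q ∧
      faceProj S * (Rᴴ * W * R) * (1 - faceProj S) = Qᴴ * (Zᴴ * W - W * Zᴴ) * Q := by
  set E := faceProj S with hE
  have hEE : E * E = E := faceProj_mul_self S
  have hEH : Eᴴ = E := conjTranspose_faceProj S
  have hEZ' : E * Zᴴ = Zᴴ := by
    have := congrArg Matrix.conjTranspose hZE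
    rwa [Matrix.conjTranspose_mul, hEH] at this
  have hZE' : Zᴴ * E = 0 := by
    have := congrArg Matrix.conjTranspose hEZ
    rwa [Matrix.conjTranspose_mul, hEH, Matrix.conjTranspose_zero] at this
  have h1' : E * Rᴴ = Qᴴ * (E + Zᴴ) := by
    have := congrArg Matrix.conjTranspose h1
    rwa [Matrix.conjTranspose_mul, Matrix.conjTranspose_mul, Matrix.conjTranspose_add, hEH] at this
  have h2' : (1 - E) * Rᴴ = Qᴴ * (1 - E - Z) := by
    have := congrArg Matrix.conjTranspose h2
    rwa [Matrix.conjTranspose_mul, Matrix.conjTranspose_mul, Matrix.conjTranspose_sub,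
      Matrix.conjTranspose_sub, Matrix.conjTranspose_sub, Matrix.conjTranspose_one, hEH,
      Matrix.conjTranspose_conjTranspose] at this
  constructor
  · rw [← lower_block_eq_commutator hEE hEZ hZE hW]
    calc _ = ((1 - E) * Rᴴ) * W * (R * E) := by simp only [mul_assoc]
      _ = _ := by rw [h1, h2']; simp only [mul_assoc]
  · rw [← upper_block_eq_commutator hEE hEZ' hZE' hW]
    calc _ = (E * Rᴴ) * W * (R * (1 - E)) := by simp only [mul_assoc]
      _ = _ := by rw [h2, h1']; simp only [mul_assoc]

/-- If Z commutes with all Wₖ, its graph is invariant, hence reducing by hypothesis, so Z* commutes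
with them too. Being an inclusion of kernels of linear maps, this improves to a quantitative bound.
-/
theorem exists_sum_norm_sq_commutator_le {S : Finset (Fin n)} {W : Fin r → CMat n}
    (hW : ∀ k, W k * faceProj S = faceProj S * W k)
    (hQ : ∀ R : CMat n, Rᴴ * R = 1 →
      (∀ k, (1 - faceProj S) * (Rᴴ * W k * R) * faceProj S = 0) →
      ∀ k, faceProj S * (Rᴴ * W k * R) * (1 - faceProj S) = 0) :
    ∃ C : ℝ, 0 ≤ C ∧ ∀ Z : CMat n, faceProj S * Z = 0 → Z * faceProj S = Z →
      ∑ k, ‖Zᴴ * W k - W k * Zᴴ‖ ^ 2 ≤ C * ∑ k, ‖W k * Z - Z * W k‖ ^ 2 := by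
  set E := faceProj S with hE
  have hEE : E * E = E := faceProj_mul_self S
  have hEF : E * (1 - E) = 0 := by rw [mul_sub, mul_one, hEE, sub_self]
  -- Taking adjoints replaces the conjugate-linear dependence on Z by the linear map Z ↦ [Wₖ*, Z].
  have hadj : ∀ (Z : CMat n) k, (W k)ᴴ * Z - Z * (W k)ᴴ = (Zᴴ * W k - W k * Zᴴ)ᴴ := fun Z k => by
    rw [Matrix.conjTranspose_sub, Matrix.conjTranspose_mul, Matrix.conjTranspose_mul,
      Matrix.conjTranspose_conjTranspose]
  have hker : LinearMap.ker (blockCommutator S W) ≤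
      LinearMap.ker (blockCommutator S fun k => (W k)ᴴ) := by
    intro X hX
    rw [LinearMap.mem_ker] at hX ⊢
    set Z := (1 - E) * (X * E) with hZ
    have hEZ : E * Z = 0 := by rw [hZ, ← mul_assoc, hEF, zero_mul]
    have hZE : Z * E = Z := by rw [hZ, mul_assoc, mul_assoc, hEE]
    obtain ⟨R, Q, hR, hQu, -, h1, h2⟩ := exists_unitary_block_eq hEZ hZE
    have hout : ∀ k, (1 - E) * (Rᴴ * W k * R) * E = 0 := fun k => by
      rw [(blocks_of_graph hEZ hZE (hW k) h1 h2).1]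
      have := congrFun hX k
      rw [blockCommutator_apply, Pi.zero_apply] at this
      rw [this, mul_zero, zero_mul]
    funext k
    rw [blockCommutator_apply, Pi.zero_apply, hadj]
    have hin := hQ R hR hout k
    rw [(blocks_of_graph hEZ hZE (hW k) h1 h2).2, hQu.mul_left_eq_zero] at hin
    have hQu' : IsUnit Qᴴ := hQu.star
    rw [hQu'.mul_right_eq_zero] at hin
    rw [hin, Matrix.conjTranspose_zero]
  obtain ⟨C, hC0, hC⟩ := LinearMap.exists_norm_le_of_ker_le _ _ hker
  refine ⟨r * C ^ 2, by positivity, fun Z hEZ hZE => ?_⟩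
  have hZ : (1 - E) * (Z * E) = Z := by rw [hZE, sub_mul, one_mul, hEZ, sub_zero]
  set a := ∑ k, ‖W k * Z - Z * W k‖ ^ 2 with ha
  have ha0 : 0 ≤ a := Finset.sum_nonneg fun _ _ => by positivity
  have hα : ‖blockCommutator S W Z‖ ≤ √a := by
    refine (pi_norm_le_iff_of_nonneg (Real.sqrt_nonneg _)).2 fun k => Real.le_sqrt_of_sq_le ?_
    rw [blockCommutator_apply, hZ]
    exact Finset.single_le_sum (f := fun k => ‖W k * Z - Z * W k‖ ^ 2)
      (fun _ _ => by positivity) (Finset.mem_univ k)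
  have hβ : ∀ k, ‖Zᴴ * W k - W k * Zᴴ‖ ^ 2 ≤ C ^ 2 * a := fun k => by
    have h1 : ‖Zᴴ * W k - W k * Zᴴ‖ ≤ C * √a := by
      have h := norm_le_pi_norm (blockCommutator S (fun k => (W k)ᴴ) Z) k
      rw [blockCommutator_apply, hZ, hadj, Matrix.frobenius_norm_conjTranspose] at h
      exact h.trans ((hC Z).trans (by gcongr))
    calc _ ≤ (C * √a) ^ 2 := by gcongr
      _ = _ := by rw [mul_pow, Real.sq_sqrt ha0]
  calc _ ≤ ∑ _k : Fin r, C ^ 2 * a := Finset.sum_le_sum fun k _ => hβ k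
    _ = _ := by simp [mul_assoc]

/-- The subspace given by R is a graph, and its off-diagonal blocks are commutators sandwiched
between D* and D. Removing and restoring the sandwich costs m⁴ each for squared norms, hence m⁸. -/
theorem sum_norm_sq_upper_block_le {S : Finset (Fin n)} {W : Fin r → CMat n}
    (hW : ∀ k, W k * faceProj S = faceProj S * W k) {C : ℝ} (hC0 : 0 ≤ C)
    (hC : ∀ Z : CMat n, faceProj S * Z = 0 → Z * faceProj S = Z →
      ∑ k, ‖Zᴴ * W k - W k * Zᴴ‖ ^ 2 ≤ C * ∑ k, ‖W k * Z - Z * W k‖ ^ 2)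
    {R D : CMat n} (hR : Rᴴ * R = 1)
    (hD : D = faceProj S * R * faceProj S + (1 - faceProj S) * R * (1 - faceProj S))
    (hDu : IsUnit D) {m : ℝ} (hm : ‖D‖ ≤ m) (hm' : ‖D⁻¹‖ ≤ m) :
    ∑ k, ‖faceProj S * (Rᴴ * W k * R) * (1 - faceProj S)‖ ^ 2 ≤
      m ^ 8 * C * ∑ k, ‖(1 - faceProj S) * (Rᴴ * W k * R) * faceProj S‖ ^ 2 := by
  obtain ⟨Z, hEZ, hZE, h1, h2⟩ := exists_graph_of_unitary hR hD hDu
  have hdet : IsUnit D.det := (Matrix.isUnit_iff_isUnit_det D).1 hDu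
  have hm0 : 0 ≤ m := (norm_nonneg _).trans hm
  have hsand : ∀ {P : CMat n}, ‖P‖ ≤ m → ∀ X : CMat n, ‖Pᴴ * X * P‖ ^ 2 ≤ m ^ 4 * ‖X‖ ^ 2 := by
    intro P hP X
    have : ‖Pᴴ * X * P‖ ≤ m * ‖X‖ * m := by
      refine (norm_mul_le _ _).trans ?_
      gcongr
      refine (norm_mul_le _ _).trans ?_
      gcongr
      rwa [Matrix.frobenius_norm_conjTranspose]
    calc _ ≤ (m * ‖X‖ * m) ^ 2 := by gcongr
      _ = _ := by ring
  have hb := fun k => blocks_of_graph hEZ hZE (hW k) h1 h2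
  have hcomm : ∀ k, W k * Z - Z * W k =
      (D⁻¹)ᴴ * ((1 - faceProj S) * (Rᴴ * W k * R) * faceProj S) * D⁻¹ := fun k => by
    have h3 : (D⁻¹)ᴴ * Dᴴ = 1 := by
      rw [← Matrix.conjTranspose_mul, Matrix.mul_nonsing_inv D hdet, Matrix.conjTranspose_one]
    calc _ = ((D⁻¹)ᴴ * Dᴴ) * (W k * Z - Z * W k) * (D * D⁻¹) := by
          rw [h3, Matrix.mul_nonsing_inv D hdet, one_mul, mul_one]
      _ = _ := by rw [(hb k).1]; simp only [mul_assoc]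
  calc _ ≤ ∑ k, m ^ 4 * ‖Zᴴ * W k - W k * Zᴴ‖ ^ 2 :=
        Finset.sum_le_sum fun k _ => by rw [(hb k).2]; exact hsand hm _
    _ ≤ m ^ 4 * (C * ∑ k, ‖W k * Z - Z * W k‖ ^ 2) := by
        rw [← Finset.mul_sum]
        gcongr
        exact hC Z hEZ hZE
    _ ≤ m ^ 4 * (C * ∑ k, m ^ 4 * ‖(1 - faceProj S) * (Rᴴ * W k * R) * faceProj S‖ ^ 2) := by
        gcongr with k
        rw [hcomm]
        exact hsand hm' _
    _ = _ := by rw [← Finset.mul_sum]; ring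

end Commutators

/-! ### The uniform bound in ≤ K · out. -/

section Compactness

variable {n r : ℕ}

/-- The diagonal blocks of `U₀* U` with respect to the decomposition given by `S`. -/
noncomputable def relativeBlocks (S : Finset (Fin n)) (U₀ U : CMat n) : CMat n :=
  faceProj S * (U₀ᴴ * U) * faceProj S + (1 - faceProj S) * (U₀ᴴ * U) * (1 - faceProj S)

theorem continuous_relativeBlocks (S : Finset (Fin n)) (U₀ : CMat n) :
    Continuous (relativeBlocks S U₀) := by
  have h : Continuous fun U : CMat n => U₀ᴴ * U := continuous_const.matrix_mul continuous_id
  exact ((continuous_const.matrix_mul h).matrix_mul continuous_const).add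
    ((continuous_const.matrix_mul h).matrix_mul continuous_const)

theorem relativeBlocks_self (S : Finset (Fin n)) {U₀ : CMat n} (hU₀ : U₀ᴴ * U₀ = 1) :
    relativeBlocks S U₀ U₀ = 1 := by
  rw [relativeBlocks, hU₀, mul_one, mul_one, one_sub_faceProj, faceProj_mul_self,
    faceProj_mul_self, ← one_sub_faceProj, add_sub_cancel]

/-- At U₀ the blocks form the identity, and invertibility is open; thus every subspace close to a
given one is a graph over it. -/
theorem eventually_isUnit_relativeBlocks (S : Finset (Fin n)) {U₀ : CMat n}
    (hU₀ : U₀ᴴ * U₀ = 1) :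
    ∀ᶠ U in 𝓝 U₀, IsUnit (relativeBlocks S U₀ U) := by
  have hdet : ∀ᶠ U in 𝓝 U₀, (relativeBlocks S U₀ U).det ≠ 0 := by
    refine ((continuous_relativeBlocks S U₀).matrix_det.continuousAt (x := U₀)).eventually_ne ?_
    rw [relativeBlocks_self S hU₀, Matrix.det_one]
    exact one_ne_zero
  exact hdet.mono fun U hU => (Matrix.isUnit_iff_isUnit_det _).2 hU.isUnit

theorem continuousAt_relativeBlocks_inv (S : Finset (Fin n)) {U₀ : CMat n}
    (hU₀ : U₀ᴴ * U₀ = 1) : ContinuousAt (fun U => (relativeBlocks S U₀ U)⁻¹) U₀ := by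
  have hc := continuous_relativeBlocks S U₀
  have h : (fun U => (relativeBlocks S U₀ U)⁻¹) =
      fun U => ((relativeBlocks S U₀ U).det)⁻¹ • (relativeBlocks S U₀ U).adjugate := by
    funext U
    rw [Matrix.inv_def, Ring.inverse_eq_inv']
  rw [h]
  refine ContinuousAt.smul (ContinuousAt.inv₀ hc.matrix_det.continuousAt ?_)
    hc.matrix_adjugate.continuousAt
  rw [relativeBlocks_self S hU₀, Matrix.det_one]
  exact one_ne_zero

theorem eventually_sum_normSq_le {f : CMat n → CMat n} {U₀ : CMat n} (hf : ContinuousAt f U₀) :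
    ∃ m : ℝ, ∀ᶠ U in 𝓝 U₀, ∑ i, ∑ j, Complex.normSq (f U i j) ≤ m := by
  have hc : Continuous fun A : CMat n => ∑ i, ∑ j, Complex.normSq (A i j) := by fun_prop
  have h := (hc.continuousAt (x := f U₀)).comp hf
  exact ⟨_, (h.eventually_lt_const (lt_add_one _)).mono fun _ h => h.le⟩

open scoped Matrix.Norms.Frobenius in
theorem exists_eventually_norm_relativeBlocks_le (S : Finset (Fin n)) {U₀ : CMat n}
    (hU₀ : U₀ᴴ * U₀ = 1) :
    ∃ m : ℝ, ∀ᶠ U in 𝓝 U₀, ‖relativeBlocks S U₀ U‖ ≤ m ∧ ‖(relativeBlocks S U₀ U)⁻¹‖ ≤ m := by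
  obtain ⟨m₁, h₁⟩ := eventually_sum_normSq_le (continuous_relativeBlocks S U₀).continuousAt (U₀ := U₀)
  obtain ⟨m₂, h₂⟩ := eventually_sum_normSq_le (continuousAt_relativeBlocks_inv S hU₀)
  refine ⟨max √m₁ √m₂, ?_⟩
  filter_upwards [h₁, h₂] with U hU₁ hU₂
  rw [← frobenius_norm_sq_eq] at hU₁ hU₂
  exact ⟨(Real.le_sqrt_of_sq_le hU₁).trans (le_max_left _ _),
    (Real.le_sqrt_of_sq_le hU₂).trans (le_max_right _ _)⟩

/-- If all invariant subspaces that correspond to a face are reducing, then the entering rates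
are dominated by the leaving rates. -/
theorem exists_inRate_le_mul_outRate {V : Fin r → CMat n} {S : Finset (Fin n)}
    (hQ : ∀ U ∈ SUn n, outRate (lindbladRate V U) S = 0 → inRate (lindbladRate V U) S = 0) :
    ∃ K : ℝ, ∀ U ∈ SUn n, inRate (lindbladRate V U) S ≤ K * outRate (lindbladRate V U) S := by
  have hnn : ∀ U, 0 ≤ outRate (lindbladRate V U) S := fun U =>
    outRate_nonneg (lindbladRate_nonneg V U) S
  refine (isCompact_SUn n).induction_on
    (p := fun s => ∃ K : ℝ, ∀ U ∈ s,
      inRate (lindbladRate V U) S ≤ K * outRate (lindbladRate V U) S)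
    ⟨0, by simp⟩ (fun s t hst ⟨K, hK⟩ => ⟨K, fun U hU => hK U (hst hU)⟩) ?_ ?_
  · rintro s t ⟨K₁, h₁⟩ ⟨K₂, h₂⟩
    refine ⟨max K₁ K₂, fun U hU => ?_⟩
    rcases hU with hU | hU
    · exact (h₁ U hU).trans (mul_le_mul_of_nonneg_right (le_max_left _ _) (hnn U))
    · exact (h₂ U hU).trans (mul_le_mul_of_nonneg_right (le_max_right _ _) (hnn U))
  intro U₀ hU₀
  suffices H : ∃ K : ℝ, ∀ᶠ U in 𝓝[SUn n] U₀,
      inRate (lindbladRate V U) S ≤ K * outRate (lindbladRate V U) S from by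
    obtain ⟨K, hK⟩ := H
    exact ⟨_, hK, K, fun U hU => hU⟩
  -- By compactness the bound is only needed near each U₀. If the out-rate vanishes there, so does
  -- the in-rate, the Wₖ are block diagonal, and the commutator estimate applies to U₀* U. Otherwise
  -- the quotient of the rates is bounded near U₀ by continuity.
  by_cases hout : outRate (lindbladRate V U₀) S = 0
  · have hin := hQ U₀ hU₀ hout
    rw [outRate_lindbladRate_eq_zero_iff] at hout
    rw [inRate_lindbladRate_eq_zero_iff] at hin
    have hU₀1 := (mem_SUn_iff.1 hU₀).1
    have hU₀2 : U₀ * U₀ᴴ = 1 := mul_eq_one_comm.1 hU₀1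
    set W : Fin r → CMat n := fun k => U₀ᴴ * V k * U₀ with hWdef
    have hconj : ∀ (R : CMat n) k, Rᴴ * W k * R = (U₀ * R)ᴴ * V k * (U₀ * R) := fun R k => by
      simp only [hWdef, Matrix.conjTranspose_mul, mul_assoc]
    have hW : ∀ k, W k * faceProj S = faceProj S * W k := fun k => by
      have h1 := hout k
      have h2 := hin k
      rw [sub_mul, one_mul, sub_mul, sub_eq_zero] at h1
      rw [mul_sub, mul_one, sub_eq_zero] at h2
      exact h1.trans h2.symm
    obtain ⟨C, hC0, hC⟩ := exists_sum_norm_sq_commutator_le hW fun R hR hRout => by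
      have hUR : (U₀ * R)ᴴ * (U₀ * R) = 1 := by
        rw [Matrix.conjTranspose_mul, mul_assoc, ← mul_assoc U₀ᴴ, hU₀1, one_mul, hR]
      obtain ⟨U', hU', hrate⟩ := exists_mem_SUn_lindbladRate_eq V hUR
      simp only [hconj] at hRout ⊢
      rw [← outRate_lindbladRate_eq_zero_iff, ← hrate] at hRout
      rw [← inRate_lindbladRate_eq_zero_iff, ← hrate]
      exact hQ U' hU' hRout
    obtain ⟨m, hm⟩ := exists_eventually_norm_relativeBlocks_le S hU₀1
    refine ⟨m ^ 8 * C, ?_⟩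
    filter_upwards [nhdsWithin_le_nhds hm,
      nhdsWithin_le_nhds (eventually_isUnit_relativeBlocks S hU₀1),
      self_mem_nhdsWithin] with U ⟨hm1, hm2⟩ hDu hU
    have hR : (U₀ᴴ * U)ᴴ * (U₀ᴴ * U) = 1 := by
      rw [Matrix.conjTranspose_mul, Matrix.conjTranspose_conjTranspose, mul_assoc,
        ← mul_assoc U₀, hU₀2, one_mul, (mem_SUn_iff.1 hU).1]
    have := sum_norm_sq_upper_block_le hW hC0 hC hR rfl hDu hm1 hm2
    simp only [hconj, ← mul_assoc U₀ U₀ᴴ, hU₀2, one_mul] at this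
    rwa [inRate_lindbladRate_eq, outRate_lindbladRate_eq]
  · have hpos : 0 < outRate (lindbladRate V U₀) S := (hnn U₀).lt_of_ne' hout
    have h1 : ∀ᶠ U in 𝓝 U₀, outRate (lindbladRate V U₀) S / 2 < outRate (lindbladRate V U) S :=
      (continuous_outRate V S).continuousAt.eventually_const_lt (by linarith)
    have h2 : ∀ᶠ U in 𝓝 U₀, inRate (lindbladRate V U) S < inRate (lindbladRate V U₀) S + 1 :=
      (continuous_inRate V S).continuousAt.eventually_lt_const (by linarith)
    have h0 := inRate_nonneg (lindbladRate_nonneg V U₀) S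
    refine ⟨(inRate (lindbladRate V U₀) S + 1) / (outRate (lindbladRate V U₀) S / 2),
      nhdsWithin_le_nhds ?_⟩
    filter_upwards [h1, h2] with U hU1 hU2
    rw [div_mul_eq_mul_div, le_div_iff₀ (by linarith)]
    exact mul_le_mul hU2.le hU1.le (by linarith) (by linarith)

end Compactness

/-! ### Averaging over the permutations preserving a face. -/

section Uniform

variable {n : ℕ}

/-- The barycenter of the face given by `S`. -/
noncomputable def faceCenter (S : Finset (Fin n)) (i : Fin n) : ℝ :=
  if i ∈ S then (S.card : ℝ)⁻¹ else 0

theorem faceCenter_mem_simplexFace {S : Finset (Fin n)} (hS : S.Nonempty) :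
    faceCenter S ∈ simplexFace S := by
  refine ⟨⟨fun i => ?_, ?_⟩, fun i hi => if_neg hi⟩
  · unfold faceCenter
    split_ifs <;> positivity
  · have : (S.card : ℝ) ≠ 0 := by exact_mod_cast hS.card_ne_zero
    simp [faceCenter, this]

theorem faceCenter_pos {S : Finset (Fin n)} {i : Fin n} (hi : i ∈ S) : 0 < faceCenter S i := by
  have : 0 < S.card := Finset.card_pos.2 ⟨i, hi⟩
  rw [faceCenter, if_pos hi]
  positivity

/-- The permutations that preserve `S`. -/
def facePerms (S : Finset (Fin n)) : Finset (Equiv.Perm (Fin n)) :=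
  Finset.univ.filter fun σ => ∀ i, σ i ∈ S ↔ i ∈ S

theorem mem_facePerms {S : Finset (Fin n)} {σ : Equiv.Perm (Fin n)} :
    σ ∈ facePerms S ↔ ∀ i, σ i ∈ S ↔ i ∈ S := by
  simp [facePerms]

theorem facePerms_compl (S : Finset (Fin n)) : facePerms Sᶜ = facePerms S := by
  ext σ
  simp only [mem_facePerms, Finset.mem_compl, not_iff_not]

theorem facePerms_nonempty (S : Finset (Fin n)) : (facePerms S).Nonempty :=
  ⟨1, mem_facePerms.2 fun _ => Iff.rfl⟩

theorem swap_mem_facePerms {S : Finset (Fin n)} {i j : Fin n} (hi : i ∈ S) (hj : j ∈ S) :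
    Equiv.swap i j ∈ facePerms S := by
  refine mem_facePerms.2 fun k => ?_
  rcases eq_or_ne k i with rfl | hki
  · simp [hi, hj]
  rcases eq_or_ne k j with rfl | hkj
  · simp [hi, hj]
  · rw [Equiv.swap_apply_of_ne_of_ne hki hkj]

theorem mul_mem_facePerms_iff {S : Finset (Fin n)} {σ τ : Equiv.Perm (Fin n)}
    (hτ : τ ∈ facePerms S) : σ * τ ∈ facePerms S ↔ σ ∈ facePerms S := by
  rw [mem_facePerms] at hτ
  simp only [mem_facePerms]
  constructor
  · intro h i
    have h1 := h (τ.symm i)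
    have h2 := hτ (τ.symm i)
    rw [Equiv.Perm.mul_apply, Equiv.apply_symm_apply] at h1
    rw [Equiv.apply_symm_apply] at h2
    exact h1.trans h2.symm
  · exact fun h i => (h (τ i)).trans (hτ i)

/-- Composition with the swap of two elements of S shows that the inner sum does not depend on i ∈
S; then sum over i and exchange the sums. -/
theorem card_mul_sum_facePerms {S : Finset (Fin n)} (a : Fin n → ℝ) {i : Fin n} (hi : i ∈ S) :
    (S.card : ℝ) * ∑ σ ∈ facePerms S, a (σ i) = (facePerms S).card * ∑ j ∈ S, a j := by
  have h1 : ∀ j ∈ S, ∑ σ ∈ facePerms S, a (σ j) = ∑ σ ∈ facePerms S, a (σ i) := fun j hj => by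
    have hτ := swap_mem_facePerms hj hi
    refine Finset.sum_equiv (Equiv.mulRight (Equiv.swap j i)) (fun σ => ?_) fun σ _ => ?_
    · exact (mul_mem_facePerms_iff hτ).symm
    · simp
  have h2 : ∀ σ ∈ facePerms S, ∑ j ∈ S, a (σ j) = ∑ j ∈ S, a j := fun σ hσ =>
    Finset.sum_equiv σ (fun j => (mem_facePerms.1 hσ j).symm) fun _ _ => rfl
  calc (S.card : ℝ) * ∑ σ ∈ facePerms S, a (σ i)
      = ∑ j ∈ S, ∑ σ ∈ facePerms S, a (σ j) := by
        rw [Finset.sum_congr rfl h1, Finset.sum_const, nsmul_eq_mul]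
    _ = ∑ σ ∈ facePerms S, ∑ j ∈ S, a (σ j) := Finset.sum_comm
    _ = _ := by rw [Finset.sum_congr rfl h2, Finset.sum_const, nsmul_eq_mul]

/-- Averaging over the permutations that preserve `S`. -/
theorem average_facePerms (S : Finset (Fin n)) (a : Fin n → ℝ) :
    ∑ σ ∈ facePerms S, ((facePerms S).card : ℝ)⁻¹ • (fun i => a (σ i)) =
      (∑ j ∈ S, a j) • faceCenter S + (∑ j ∈ Sᶜ, a j) • faceCenter Sᶜ := by
  have hG : ((facePerms S).card : ℝ) ≠ 0 := by exact_mod_cast (facePerms_nonempty S).card_ne_zero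
  funext i
  simp only [Finset.sum_apply, Pi.smul_apply, smul_eq_mul, Pi.add_apply, ← Finset.mul_sum,
    faceCenter, Finset.mem_compl]
  by_cases hi : i ∈ S
  · have hS : (S.card : ℝ) ≠ 0 := by exact_mod_cast (Finset.card_pos.2 ⟨i, hi⟩).ne'
    have := card_mul_sum_facePerms a hi
    simp only [hi, if_true, not_true, if_false, mul_zero, add_zero]
    field_simp
    linarith
  · have hi' : i ∈ Sᶜ := Finset.mem_compl.2 hi
    have hS : ((Sᶜ : Finset (Fin n)).card : ℝ) ≠ 0 := by
      exact_mod_cast (Finset.card_pos.2 ⟨i, hi'⟩).ne'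
    have := card_mul_sum_facePerms a hi'
    rw [facePerms_compl] at this
    simp only [hi, if_false, not_false_eq_true, if_true, mul_zero, zero_add]
    field_simp
    linarith

theorem faceCenter_comp_perm {S : Finset (Fin n)} {σ : Equiv.Perm (Fin n)} (hσ : σ ∈ facePerms S)
    (i : Fin n) : faceCenter S (σ i) = faceCenter S i := by
  simp only [faceCenter, mem_facePerms.1 hσ i]

theorem rateField_perm {J : Fin n → Fin n → ℝ} {σ : Equiv.Perm (Fin n)} {x : Fin n → ℝ}
    (hx : ∀ i, x (σ i) = x i) :
    rateField (fun i j => J (σ i) (σ j)) x = fun i => rateField J x (σ i) := by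
  funext i
  rw [rateField_apply, rateField_apply, hx, Equiv.sum_comp σ fun j => J j (σ i),
    ← Equiv.sum_comp σ fun j => J (σ i) j * x j]
  simp only [hx]

end Uniform

/-! ### Direct reachability from an entering control. -/

section Direct

variable {n r : ℕ} {V : Fin r → CMat n}

/-- Some control leaves the face given by `S` invariant and makes some mass enter it. -/
def HasEnteringControl (V : Fin r → CMat n) (S : Finset (Fin n)) : Prop :=
  ∃ U ∈ SUn n, outRate (lindbladRate V U) S = 0 ∧ inRate (lindbladRate V U) S ≠ 0

/-- States on the line through the two barycenters are fixed by the permutations preserving S.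
Averaging the permuted controls therefore makes the velocity constant on S and on its complement, so
it points along this line; the mass balance determines its length. -/
theorem HasEnteringControl.exists_mem_convexHull_derv {L : CMat n → CMat n} (hD : HasRates L V)
    {S : Finset (Fin n)} (hQ : HasEnteringControl V S) :
    ∃ γ > 0, ∀ s : ℝ, (γ * s) • (faceCenter S - faceCenter Sᶜ) ∈
      convexHull ℝ (derv L ((1 - s) • faceCenter S + s • faceCenter Sᶜ)) := by
  obtain ⟨U, hU, hout, hin⟩ := hQ
  set J := lindbladRate V U with hJdef
  have hJ : ∀ i j, 0 ≤ J i j := lindbladRate_nonneg V U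
  rw [outRate_eq_zero_iff hJ] at hout
  have hin0 : 0 < inRate J S := (inRate_nonneg hJ S).lt_of_ne' hin
  have hT : (Sᶜ : Finset (Fin n)).Nonempty := by
    by_contra h
    rw [Finset.not_nonempty_iff_eq_empty] at h
    simp [inRate, h] at hin0
  have hTc : (0 : ℝ) < (Sᶜ : Finset (Fin n)).card := by exact_mod_cast hT.card_pos
  refine ⟨inRate J S / (Sᶜ : Finset (Fin n)).card, by positivity, fun s => ?_⟩
  set γ := inRate J S / (Sᶜ : Finset (Fin n)).card with hγ
  set x := (1 - s) • faceCenter S + s • faceCenter Sᶜ with hx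
  set a := rateField J x with ha
  have hxT : ∀ i ∈ Sᶜ, x i = s * ((Sᶜ : Finset (Fin n)).card : ℝ)⁻¹ := fun i hi => by
    simp [hx, faceCenter, Finset.mem_compl.1 hi]
  have haT : ∑ j ∈ Sᶜ, a j = -(γ * s) := by
    rw [← outerMass_apply, ha, outerMass_rateField]
    have h1 : ∑ i ∈ Sᶜ, ∑ j ∈ S, J i j * x j = 0 :=
      Finset.sum_eq_zero fun i hi => Finset.sum_eq_zero fun j hj => by
        rw [hout i (Finset.mem_compl.1 hi) j hj, zero_mul]
    have h2 : ∑ i ∈ Sᶜ, ∑ j ∈ S, J j i * x i =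
        inRate J S * (s * ((Sᶜ : Finset (Fin n)).card : ℝ)⁻¹) := by
      rw [inRate, Finset.sum_mul]
      refine Finset.sum_congr rfl fun i hi => ?_
      rw [hxT i hi, Finset.sum_mul]
    rw [h1, h2, hγ]
    ring
  have haS : ∑ j ∈ S, a j = γ * s := by
    have h1 := sum_rateField_apply J x
    rw [← Finset.sum_add_sum_compl S, haT] at h1
    linarith
  have hmem : ∑ σ ∈ facePerms S, ((facePerms S).card : ℝ)⁻¹ • (fun i => a (σ i)) ∈
      convexHull ℝ (derv L x) := by
    refine (convex_convexHull ℝ _).sum_mem (fun _ _ => by positivity) ?_ fun σ hσ =>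
      subset_convexHull ℝ _ ?_
    · rw [Finset.sum_const, nsmul_eq_mul, mul_inv_cancel₀]
      exact_mod_cast (facePerms_nonempty S).card_ne_zero
    · obtain ⟨U', hU', hrate⟩ := exists_mem_SUn_lindbladRate_perm V hU σ
      refine ⟨U', hU', ?_⟩
      have hJ' : lindbladRate V U' = fun i j => J (σ i) (σ j) := by
        funext i j; exact hrate i j
      have hσ' : σ ∈ facePerms Sᶜ := by rwa [facePerms_compl]
      dsimp only
      rw [hD U' hU', hJ', rateField_perm]
      intro i
      simp only [hx, Pi.add_apply, Pi.smul_apply, faceCenter_comp_perm hσ,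
        faceCenter_comp_perm hσ']
  rw [average_facePerms, haS, haT] at hmem
  convert hmem using 1
  module

/-- A solution that moves from the barycenter of the opposite face to the barycenter. -/
theorem HasEnteringControl.exists_isRelaxedSolution {L : CMat n → CMat n} (hD : HasRates L V)
    {S : Finset (Fin n)} (hS : S.Nonempty) (hS' : S ≠ Finset.univ) (hQ : HasEnteringControl V S) :
    ∃ x : ℝ → Fin n → ℝ, IsRelaxedSolution L (Ici 0) x ∧ x 0 = faceCenter Sᶜ ∧
      Tendsto x atTop (𝓝 (faceCenter S)) := by
  obtain ⟨γ, hγ, hv⟩ := hQ.exists_mem_convexHull_derv hD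
  have hT : (Sᶜ : Finset (Fin n)).Nonempty := by
    rwa [← Finset.compl_ne_univ_iff_nonempty, compl_compl]
  -- The outer mass solves s' = -γ s with s(0) = 1.
  set s : ℝ → ℝ := fun t => Real.exp (-(γ * t)) with hs
  have hsd : ∀ t, HasDerivAt s (-(γ * s t)) t := fun t => by
    have h : HasDerivAt (fun u : ℝ => Real.exp (-(γ * u))) (Real.exp (-(γ * t)) * -(γ * 1)) t :=
      ((hasDerivAt_id' t).const_mul γ).fun_neg.exp
    convert h using 1
    simp only [hs]
    ring
  set x : ℝ → Fin n → ℝ := fun t => (1 - s t) • faceCenter S + s t • faceCenter Sᶜ with hx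
  have hxd : ∀ t, HasDerivAt x ((γ * s t) • (faceCenter S - faceCenter Sᶜ)) t := fun t => by
    have h := (((hsd t).const_sub 1).smul_const (faceCenter S)).add
      ((hsd t).smul_const (faceCenter Sᶜ))
    have he : (-(-(γ * s t))) • faceCenter S + (-(γ * s t)) • faceCenter Sᶜ =
        (γ * s t) • (faceCenter S - faceCenter Sᶜ) := by module
    rw [he] at h
    exact h
  have hs0 : ∀ t, 0 ≤ s t := fun t => (Real.exp_pos _).le
  have hs1 : ∀ t ∈ Ici (0 : ℝ), s t ≤ 1 := fun t ht => by
    rw [Real.exp_le_one_iff, neg_nonpos]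
    exact mul_nonneg hγ.le ht
  refine ⟨x, ⟨fun t ht => ?_, ?_, ?_⟩, ?_, ?_⟩
  · exact convex_stdSimplex ℝ (Fin n) (faceCenter_mem_simplexFace hS).1
      (faceCenter_mem_simplexFace hT).1 (sub_nonneg.2 (hs1 t ht)) (hs0 t) (sub_add_cancel _ _)
  · refine absContOn_of_norm_hasDerivAt_le (C := γ * ‖faceCenter S - faceCenter Sᶜ‖) ordConnected_Ici
      (fun t _ => hxd t) fun t ht => ?_
    rw [norm_smul, Real.norm_of_nonneg (mul_nonneg hγ.le (hs0 t))]
    gcongr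
    exact mul_le_of_le_one_right hγ.le (hs1 t ht)
  · exact Eventually.of_forall fun t => ⟨_, hv (s t), hxd t⟩
  · simp [hx, hs]
  · have hst : Tendsto s atTop (𝓝 0) :=
      Real.tendsto_exp_neg_atTop_nhds_zero.comp (tendsto_id.const_mul_atTop hγ)
    have := ((hst.const_sub 1).smul_const (faceCenter S)).add (hst.smul_const (faceCenter Sᶜ))
    simpa using this

theorem faceCenter_notMem_simplexFace {S T : Finset (Fin n)} {i : Fin n} (hi : i ∉ S)
    (hiT : i ∈ T) : faceCenter T ∉ simplexFace S := fun h =>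
  (faceCenter_pos hiT).ne' (h.2 i hi)

theorem HasEnteringControl.isDirectlyReachable {L : CMat n → CMat n} (hD : HasRates L V)
    {S : Finset (Fin n)} (hS : S.Nonempty) (hS' : S ≠ Finset.univ) (hQ : HasEnteringControl V S) :
    IsDirectlyReachable L (simplexFace S) := by
  obtain ⟨x, hx, hx0, hlim⟩ := hQ.exists_isRelaxedSolution hD hS hS'
  obtain ⟨i, hi⟩ : ∃ i, i ∉ S := by
    by_contra! h
    exact hS' (Finset.eq_univ_iff_forall.2 h)
  refine ⟨x, hx, ?_, faceCenter S, mem_intrinsicInterior_simplexFace.2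
    ⟨faceCenter_mem_simplexFace hS, fun i hi => faceCenter_pos hi⟩, hlim⟩
  rw [hx0]
  exact faceCenter_notMem_simplexFace hi (Finset.mem_compl.2 hi)

theorem HasEnteringControl.of_card_eq {S T : Finset (Fin n)} (hQ : HasEnteringControl V T)
    (hcard : S.card = T.card) : HasEnteringControl V S := by
  obtain ⟨U, hU, hout, hin⟩ := hQ
  set σ : Equiv.Perm (Fin n) := (Finset.equivOfCardEq hcard).extendSubtype with hσ
  have hmem : ∀ i, σ i ∈ T ↔ i ∈ S := fun i => by
    refine ⟨fun h => ?_, fun h => Equiv.extendSubtype_mem _ i h⟩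
    by_contra hi
    exact Equiv.extendSubtype_not_mem (Finset.equivOfCardEq hcard) i hi h
  obtain ⟨U', hU', hrate⟩ := exists_mem_SUn_lindbladRate_perm V hU σ
  have hsum : ∀ a : Fin n → Fin n → ℝ,
      ∑ i ∈ Sᶜ, ∑ j ∈ S, a (σ i) (σ j) = ∑ i ∈ Tᶜ, ∑ j ∈ T, a i j := fun a =>
    Finset.sum_equiv σ (fun i => by simp [hmem]) fun i _ =>
      Finset.sum_equiv σ (fun j => (hmem j).symm) fun _ _ => rfl
  refine ⟨U', hU', ?_, ?_⟩
  · rw [← hout]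
    simp only [outRate, hrate]
    exact hsum (lindbladRate V U)
  · have : inRate (lindbladRate V U') S = inRate (lindbladRate V U) T := by
      simp only [inRate, hrate]
      exact hsum fun i j => lindbladRate V U j i
    rwa [this]

end Direct

/-! ### Motion inside an invariant face. -/

section Invariance

variable {n r : ℕ} {V : Fin r → CMat n}

theorem exp_rateField_mem_simplexFace {J : Fin n → Fin n → ℝ} (hJ : ∀ i j, 0 ≤ J i j)
    {S : Finset (Fin n)} (hout : outRate J S = 0) {x : Fin n → ℝ} (hx : x ∈ simplexFace S)
    {t : ℝ} (ht : 0 ≤ t) : NormedSpace.exp (t • rateField J) x ∈ simplexFace S := by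
  have hΔ : ∀ s : ℝ, 0 ≤ s → NormedSpace.exp (s • rateField J) x ∈ stdSimplex ℝ (Fin n) :=
    fun s hs => (isStochasticMap_exp_rateField hJ hs).mem_stdSimplex hx.1
  rw [← outerMass_eq_zero_iff (hΔ t ht)]
  refine le_antisymm ?_ (outerMass_nonneg S (hΔ t ht).1)
  rw [← neg_nonneg]
  refine nonneg_of_hasDerivAt_nonneg_of_nonpos
    (g := fun s => -outerMass S (NormedSpace.exp (s • rateField J) x))
    (fun s => ((outerMass S).hasFDerivAt.comp_hasDerivAt s
      (hasDerivAt_exp_smul_apply (rateField J) x s)).neg) ?_ (fun s hs _ => ?_) ht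
  · simp [(outerMass_eq_zero_iff hx.1).2 hx]
  · rw [outRate_eq_zero_iff hJ] at hout
    rw [neg_nonneg, outerMass_rateField]
    refine sub_nonpos.2 (le_trans (le_of_eq ?_) (Finset.sum_nonneg fun i _ =>
      Finset.sum_nonneg fun j _ => mul_nonneg (hJ j i) ((hΔ s hs).1 i)))
    exact Finset.sum_eq_zero fun i hi => Finset.sum_eq_zero fun j hj => by
      rw [hout i (Finset.mem_compl.1 hi) j hj, zero_mul]

theorem isViable_of_outRate_eq_zero {L : CMat n → CMat n} (hD : HasRates L V)
    {S : Finset (Fin n)} {U : CMat n} (hU : U ∈ SUn n)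
    (hout : outRate (lindbladRate V U) S = 0) : IsViable L (simplexFace S) := by
  intro x₀ hx₀
  set M := rateField (lindbladRate V U) with hM
  have hmem : ∀ t : ℝ, 0 ≤ t → NormedSpace.exp (t • M) x₀ ∈ simplexFace S := fun t ht =>
    exp_rateField_mem_simplexFace (lindbladRate_nonneg V U) hout hx₀ ht
  refine ⟨fun t => NormedSpace.exp (t • M) x₀, ⟨fun t ht => (hmem t ht).1, ?_, ?_⟩, by simp, hmem⟩
  · refine absContOn_of_norm_hasDerivAt_le (C := ‖M‖) ordConnected_Ici
      (fun t _ => hasDerivAt_exp_smul_apply M x₀ t) fun t ht => ?_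
    exact (M.le_opNorm _).trans
      (mul_le_of_le_one_right (norm_nonneg M) (norm_le_one_of_mem_stdSimplex (hmem t ht).1))
  · exact Eventually.of_forall fun t => ⟨_, subset_convexHull ℝ _ ⟨U, hU, hD U hU _⟩,
      hasDerivAt_exp_smul_apply M x₀ t⟩

/-- A control that is tangent to a face but does not vanish on it moves mass inside the face. -/
theorem exists_rate_pos_of_not_isPurelyHamiltonianFace {L : CMat n → CMat n} (hD : HasRates L V)
    {S : Finset (Fin n)} (hS : S.Nonempty) (h : ¬ IsPurelyHamiltonianFace L (simplexFace S)) :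
    ∃ U ∈ SUn n, outRate (lindbladRate V U) S = 0 ∧
      ∃ a ∈ S, ∃ b ∈ S, a ≠ b ∧ 0 < lindbladRate V U a b := by
  unfold IsPurelyHamiltonianFace at h
  push Not at h
  obtain ⟨U, hU, htan, x, hx, hne⟩ := h
  set J := lindbladRate V U with hJdef
  have hJ : ∀ i j, 0 ≤ J i j := lindbladRate_nonneg V U
  -- Tangency is tested at the barycenter, where all coordinates in S are positive, so a vanishing
  -- sum of nonnegative terms kills every leaving rate.
  have hout : ∀ i ∉ S, ∀ j ∈ S, J i j = 0 := fun i hi j hj => by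
    have h1 := apply_eq_zero_of_mem_vectorSpan_simplexFace
      (htan _ (faceCenter_mem_simplexFace hS)) hi
    rw [hD U hU, rateField_apply, (faceCenter_mem_simplexFace hS).2 i hi, mul_zero, sub_zero] at h1
    have h2 := (Finset.sum_eq_zero_iff_of_nonneg fun k _ =>
      mul_nonneg (hJ i k) ((faceCenter_mem_simplexFace hS).1.1 k)).1 h1 j (Finset.mem_univ j)
    exact (mul_eq_zero.1 h2).resolve_right (faceCenter_pos hj).ne'
  refine ⟨U, hU, (outRate_eq_zero_iff hJ).2 hout, ?_⟩
  by_contra! hzero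
  have hzero' : ∀ a ∈ S, ∀ b ∈ S, a ≠ b → J a b = 0 := fun a ha b hb hab =>
    le_antisymm (hzero a ha b hb hab) (hJ a b)
  refine hne ?_
  rw [hD U hU, ← hJdef]
  funext i
  rw [rateField_apply, Pi.zero_apply]
  by_cases hi : i ∈ S
  · rw [Finset.sum_eq_single i, Finset.sum_eq_single i, sub_self]
    · intro j _ hji
      by_cases hj : j ∈ S
      · exact hzero' j hj i hi hji
      · exact hout j hj i hi
    · exact fun h => absurd (Finset.mem_univ i) h
    · intro j _ hji
      by_cases hj : j ∈ S
      · rw [hzero' i hi j hj hji.symm, zero_mul]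
      · rw [hx.2 j hj, mul_zero]
    · exact fun h => absurd (Finset.mem_univ i) h
  · rw [hx.2 i hi, mul_zero, sub_zero]
    refine Finset.sum_eq_zero fun j _ => ?_
    by_cases hj : j ∈ S
    · rw [hout i hi j hj, zero_mul]
    · rw [hx.2 j hj, mul_zero]

/-- The permutations preserving S act doubly transitively on it, so a single internal transition
yields one between any two distinct vertices of the face. -/
theorem exists_facePerms_apply_eq {S : Finset (Fin n)} {a b a' b' : Fin n} (ha : a ∈ S)
    (hb : b ∈ S) (ha' : a' ∈ S) (hb' : b' ∈ S) (hab : a ≠ b) (hab' : a' ≠ b') :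
    ∃ σ ∈ facePerms S, σ a' = a ∧ σ b' = b := by
  have h1 := swap_mem_facePerms ha' ha
  set c := Equiv.swap a' a b' with hc
  have hcS : c ∈ S := (mem_facePerms.1 h1 b').2 hb'
  have hca : a ≠ c := fun h => hab' ((Equiv.swap a' a).injective (by
    rw [← hc, ← h, Equiv.swap_apply_left]))
  refine ⟨Equiv.swap c b * Equiv.swap a' a,
    (mul_mem_facePerms_iff h1).2 (swap_mem_facePerms hcS hb), ?_, ?_⟩
  · rw [Equiv.Perm.mul_apply, Equiv.swap_apply_left, Equiv.swap_apply_of_ne_of_ne hca hab]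
  · rw [Equiv.Perm.mul_apply, ← hc, Equiv.swap_apply_left]

/-- At time zero the empty coordinate a has derivative at least J_ab z_b > 0, and positive
coordinates stay positive for a short time. -/
theorem exists_exp_rateField_pos {J : Fin n → Fin n → ℝ} (hJ : ∀ i j, 0 ≤ J i j) {z : Fin n → ℝ}
    (hz : 0 ≤ z) {a b : Fin n} (hab : 0 < J a b) (hza : z a = 0) (hzb : 0 < z b) :
    ∃ t : ℝ, 0 ≤ t ∧ 0 < NormedSpace.exp (t • rateField J) z a ∧
      ∀ i, 0 < z i → 0 < NormedSpace.exp (t • rateField J) z i := by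
  set p : ℝ → Fin n → ℝ := fun t => NormedSpace.exp (t • rateField J) z with hp
  have hp0 : p 0 = z := by simp [hp]
  have hpd : ∀ i, HasDerivAt (fun t => p t i) (rateField J z i) 0 := fun i => by
    have := hasDerivAt_pi.1 (hasDerivAt_exp_smul_apply (rateField J) z 0) i
    simpa using this
  have h1 : ∀ᶠ t in 𝓝[>] (0 : ℝ), ∀ i, 0 < z i → 0 < p t i := by
    refine eventually_all.2 fun i => ?_
    by_cases hi : 0 < z i
    · have := (hpd i).continuousAt.eventually_const_lt (u := 0)
        (by change 0 < p 0 i; rw [hp0]; exact hi)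
      exact nhdsWithin_le_nhds (this.mono fun t ht _ => ht)
    · exact Eventually.of_forall fun t h => absurd h hi
  have hda : 0 < rateField J z a := by
    rw [rateField_apply, hza, mul_zero, sub_zero]
    refine Finset.sum_pos' (fun j _ => mul_nonneg (hJ a j) (hz j))
      ⟨b, Finset.mem_univ b, mul_pos hab hzb⟩
  have h2 : ∀ᶠ t in 𝓝[>] (0 : ℝ), 0 < p t a := by
    have hsign := eventually_nhdsWithin_sign_eq_of_deriv_pos (f := fun t => p t a) (x₀ := 0)
      (by rw [(hpd a).deriv]; exact hda) (by rw [hp0]; exact hza)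
    filter_upwards [nhdsWithin_le_nhds hsign, self_mem_nhdsWithin] with t ht ht0
    rw [sub_zero, sign_pos (mem_Ioi.1 ht0), sign_eq_one_iff] at ht
    exact ht
  obtain ⟨t, h1, h2, h3⟩ := (h1.and (h2.and self_mem_nhdsWithin)).exists
  exact ⟨t, le_of_lt h3, h2, h1⟩

/-- Inside a face that is not purely Hamiltonian one can reach the relative interior. -/
theorem exists_mem_intrinsicInterior_of_mem_simplexFace {L : CMat n → CMat n} (hD : HasRates L V)
    {S : Finset (Fin n)} (hS : S.Nonempty) (h : ¬ IsPurelyHamiltonianFace L (simplexFace S))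
    {x y : Fin n → ℝ} (hy : y ∈ closure (flowOrbit V x)) (hyS : y ∈ simplexFace S) :
    ∃ z ∈ intrinsicInterior ℝ (simplexFace S), z ∈ closure (flowOrbit V x) := by
  classical
  obtain ⟨U, hU, hout, a, ha, b, hb, hab, hJab⟩ :=
    exists_rate_pos_of_not_isPurelyHamiltonianFace hD hS h
  -- Induction on the number of positive coordinates: a permuted control carries mass from an
  -- occupied vertex b' to an empty one a' without leaving the face or emptying an occupied vertex.
  have key : ∀ k ≤ S.card, ∃ z ∈ closure (flowOrbit V x), z ∈ simplexFace S ∧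
      k ≤ (S.filter fun i => 0 < z i).card := by
    intro k
    induction k with
    | zero => exact fun _ => ⟨y, hy, hyS, Nat.zero_le _⟩
    | succ k ih =>
      intro hk
      obtain ⟨z, hz, hzS, hzk⟩ := ih (Nat.le_of_succ_le hk)
      rcases hzk.lt_or_eq with hlt | heq
      · exact ⟨z, hz, hzS, hlt⟩
      obtain ⟨a', ha', hza'⟩ : ∃ a' ∈ S, ¬ 0 < z a' := by
        by_contra! hall
        rw [Finset.filter_true_of_mem hall] at heq
        omega
      have hza0 : z a' = 0 := le_antisymm (not_lt.1 hza') (hzS.1.1 a')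
      obtain ⟨b', hb', hzb'⟩ : ∃ b' ∈ S, 0 < z b' := by
        by_contra! hall
        have h0 : ∀ i, z i = 0 := fun i => by
          by_cases hi : i ∈ S
          · exact le_antisymm (hall i hi) (hzS.1.1 i)
          · exact hzS.2 i hi
        have := hzS.1.2
        simp [h0] at this
      have hab' : a' ≠ b' := fun h => hza' (h ▸ hzb')
      obtain ⟨σ, hσ, hσa, hσb⟩ := exists_facePerms_apply_eq ha hb ha' hb' hab hab'
      obtain ⟨U', hU', hrate⟩ := exists_mem_SUn_lindbladRate_perm V hU σ
      have hJ' := lindbladRate_nonneg V U'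
      have hout' : outRate (lindbladRate V U') S = 0 := by
        rw [outRate_eq_zero_iff (lindbladRate_nonneg V U)] at hout
        refine (outRate_eq_zero_iff hJ').2 fun i hi j hj => ?_
        rw [hrate]
        exact hout _ (fun h => hi ((mem_facePerms.1 hσ i).1 h)) _ ((mem_facePerms.1 hσ j).2 hj)
      obtain ⟨t, ht, hta, htpos⟩ := exists_exp_rateField_pos hJ' hzS.1.1 (a := a') (b := b')
        (by rw [hrate, hσa, hσb]; exact hJab) hza0 hzb'
      refine ⟨_, flow_apply_mem_closure_flowOrbit hz (exp_mem_flows ht ⟨U', hU', rfl⟩),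
        exp_rateField_mem_simplexFace hJ' hout' hzS ht, ?_⟩
      rw [heq, Nat.succ_le_iff]
      refine Finset.card_lt_card ((Finset.ssubset_iff_of_subset fun i hi => ?_).2
        ⟨a', Finset.mem_filter.2 ⟨ha', hta⟩, fun h => hza' (Finset.mem_filter.1 h).2⟩)
      obtain ⟨h1, h2⟩ := Finset.mem_filter.1 hi
      exact Finset.mem_filter.2 ⟨h1, htpos i h2⟩
  obtain ⟨z, hz, hzS, hcard⟩ := key S.card le_rfl
  have hfilter := Finset.eq_of_subset_of_card_le (Finset.filter_subset _ S) hcard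
  refine ⟨z, mem_intrinsicInterior_simplexFace.2 ⟨hzS, fun i hi => ?_⟩, hz⟩
  rw [← hfilter] at hi
  exact (Finset.mem_filter.1 hi).2

end Invariance

/-! ### The dichotomy and the descent through faces. -/

section Main

variable {n r : ℕ} {V : Fin r → CMat n}

theorem exists_inRate_le_of_not_hasEnteringControl {S : Finset (Fin n)}
    (hQ : ¬ HasEnteringControl V S) :
    ∃ K : ℝ, ∀ U ∈ SUn n, inRate (lindbladRate V U) S ≤ K * outRate (lindbladRate V U) S :=
  exists_inRate_le_mul_outRate fun U hU hout => by
    by_contra hin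
    exact hQ ⟨U, hU, hout, hin⟩

theorem IsApproxReachable.lowerFace_of_not_hasEnteringControl {L : CMat n → CMat n}
    (hD : HasRates L V) {S : Finset (Fin n)} (hS : IsApproxReachable L (simplexFace S))
    (hQ : ¬ HasEnteringControl V S) : LowerFaceApproxReachable L S := by
  obtain ⟨K, hK⟩ := exists_inRate_le_of_not_hasEnteringControl hQ
  exact exists_lowerFace_isApproxReachable hD hK hS

theorem IsApproxReachable.isViable {L : CMat n → CMat n}
    (hD : HasRates L V) {S : Finset (Fin n)} (hS : IsApproxReachable L (simplexFace S)) :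
    IsViable L (simplexFace S) := by
  obtain ⟨x, hx, hxS, y, hy, hycl⟩ := (isApproxReachable_iff hD).1 hS
  obtain ⟨hyS, hypos⟩ := mem_intrinsicInterior_simplexFace.1 hy
  obtain ⟨U, hU, hout⟩ := exists_outRate_eq_zero hx hxS hycl hyS hypos
  exact isViable_of_outRate_eq_zero hD hU hout

/-- A face without an entering control passes approximate reachability to a strictly smaller
nonempty face, so the descent must stop at one that has such a control. -/
theorem IsApproxReachable.exists_hasEnteringControl {L : CMat n → CMat n} (hD : HasRates L V)
    {S : Finset (Fin n)} (hSne : S.Nonempty) (hS : IsApproxReachable L (simplexFace S)) :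
    ∃ T : Finset (Fin n), T.Nonempty ∧ T.card ≤ S.card ∧ HasEnteringControl V T := by
  induction hm : S.card using Nat.strong_induction_on generalizing S with
  | _ m ih =>
    by_cases hQ : HasEnteringControl V S
    · exact ⟨S, hSne, hm.le, hQ⟩
    · obtain ⟨T, hT, hTS, hTr⟩ := hS.lowerFace_of_not_hasEnteringControl hD hQ
      obtain ⟨T', hT', hcard, hQ'⟩ := ih T.card (hm ▸ hTS) hT hTr rfl
      exact ⟨T', hT', by omega, hQ'⟩

theorem isApproxReachable_of_lowerFace {L : CMat n → CMat n} (hD : HasRates L V)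
    {S : Finset (Fin n)} (hS : S.Nonempty) (hS' : S ≠ Finset.univ)
    (h : ¬ IsPurelyHamiltonianFace L (simplexFace S)) (hlow : LowerFaceApproxReachable L S) :
    IsApproxReachable L (simplexFace S) := by
  obtain ⟨T₀, hT₀, hT₀S, hT₀r⟩ := hlow
  obtain ⟨T₁, hT₁, hT₁c, hQ₁⟩ := hT₀r.exists_hasEnteringControl hD hT₀
  -- The face with an entering control need not lie in F, but existence of such a control depends
  -- only on the dimension, so a face of equal size inside F serves.
  obtain ⟨T, hTS, hTc⟩ := Finset.exists_subset_card_eq (hT₁c.trans hT₀S.le)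
  have hT : T.Nonempty := Finset.card_pos.1 (hTc ▸ hT₁.card_pos)
  obtain ⟨i, hi⟩ : ∃ i, i ∉ S := by
    by_contra! h
    exact hS' (Finset.eq_univ_iff_forall.2 h)
  have hiT : i ∉ T := fun h => hi (hTS h)
  have hTu : T ≠ Finset.univ := fun h => hiT (h ▸ Finset.mem_univ i)
  obtain ⟨x, hx, hx0, hlim⟩ := (hQ₁.of_card_eq hTc).exists_isRelaxedSolution hD hT hTu
  have hcl : faceCenter T ∈ closure (flowOrbit V (faceCenter Tᶜ)) := by
    rw [← hx0]
    refine isClosed_closure.mem_of_tendsto hlim ?_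
    filter_upwards [eventually_ge_atTop 0] with t ht
    exact hx.mem_closure_flowOrbit hD ht Icc_subset_Ici_self
  have hTF := faceCenter_mem_simplexFace hT
  obtain ⟨z, hz, hzcl⟩ := exists_mem_intrinsicInterior_of_mem_simplexFace hD hS h hcl
    ⟨hTF.1, fun j hj => hTF.2 j fun hjT => hj (hTS hjT)⟩
  exact (isApproxReachable_iff hD).2 ⟨faceCenter Tᶜ,
    (faceCenter_mem_simplexFace ⟨i, Finset.mem_compl.2 hiT⟩).1,
    faceCenter_notMem_simplexFace hi (Finset.mem_compl.2 hiT), z, hz, hzcl⟩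

end Main

theorem mainTheorem11 {n : ℕ} (L : CMat n → CMat n) (hL : -L ∈ KossakowskiLindblad n)
    (S : Finset (Fin n)) (hS : S.Nonempty) (hS' : S ≠ Finset.univ) :
    ((IsDirectlyReachable L (simplexFace S) ∨
        (IsViable L (simplexFace S) ∧ ¬ IsPurelyHamiltonianFace L (simplexFace S) ∧
          LowerFaceApproxReachable L S)) →
      IsApproxReachable L (simplexFace S)) ∧
    (IsApproxReachable L (simplexFace S) →
      (IsDirectlyReachable L (simplexFace S) ∨
        (IsViable L (simplexFace S) ∧ LowerFaceApproxReachable L S))) := by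
  obtain ⟨r, V, hD⟩ := exists_hasRates hL
  refine ⟨?_, fun h => ?_⟩
  · rintro (h | ⟨-, hH, hlow⟩)
    · exact h.isApproxReachable hD
    · exact isApproxReachable_of_lowerFace hD hS hS' hH hlow
  · by_cases hQ : HasEnteringControl V S
    · exact Or.inl (hQ.isDirectlyReachable hD hS hS')
    · exact Or.inr ⟨h.isViable hD, h.lowerFace_of_not_hasEnteringControl hD hQ⟩
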